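/- Let $k\ge 1$ and let $\Lambda$ be a row-finite $k$-graph with no sources: a countable small category with a degree functor $d:\Lambda\to\mathbb N^k$ satisfying the factorization property, such that for every vertex $v$ and every $n\in\mathbb N^k$ the set $v\Lambda^n$ of paths of range $v$ and degree $n$ is finite and nonempty. Write $r,s$ for range and source. Let $\Lambda^\infty$ be the space of infinite paths (degree-preserving functors $\Omega_k\to\Lambda$), with the $\sigma$-algebra generated by the cylinder sets $Z(\lambda)=\{x: x(0,d(\lambda))=\lambda\}$, with shift maps $\sigma^n(x)(p,q)=x(p+n,q+n)$ (the standard coding maps) and maps $\sigma_\lambda: Z(s(\lambda))\to Z(\lambda)$, $x\mapsto\lambda x$ (the standard prefixing maps). Let $C^*(\Lambda)$ be the universal $C^*$-algebra of a Cuntz–Krieger $\Lambda$-family $\{s_\lambda\}_{\lambda\in\Lambda}$. A representation $\pi$ of $C^*(\Lambda)$ on a complex Hilbert space $\mathcal H$, with $t_\lambda=\pi(s_\lambda)$, is *monic* if $t_\lambda\ne 0$ for all $\lambda$ and there is a vector $\xi\in\mathcal H$ (a *monic vector*) with $\overline{\operatorname{span}}\{t_\lambda t_\lambda^*\xi:\lambda\in\Lambda\}=\mathcal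 H$. For a monic vector $\xi$, $\mu_\pi$ denotes the measure on $\Lambda^\infty$ with $\mu_\pi(Z(\lambda))=\langle\xi,t_\lambda t_\lambda^*\xi\rangle$ for all $\lambda$. A *semibranching function system* on a measure space $(X,\mu)$ is a countable family of measurable maps $\tau_i:D_i\to X$ with $0<\mu(D_i)<\infty$, whose ranges $R_i=\tau_i(D_i)$ are measurable, of finite measure, pairwise disjoint up to null sets, and cover $X$ up to a null set, and such that $\frac{d(\mu\circ\tau_i)}{d\mu}$ exists and is strictly positive a.e. on $D_i$; a *coding map* for it is a measurable $\tau:X\to X$ with $\tau\circ\tau_i=\mathrm{id}_{D_i}$ for all $i$. A *$\Lambda$-semibranching function system* on $(X,\mu)$ consists of maps $\tau_\lambda:D_\lambda\to X$ ($\lambda\in\Lambda$) and $\tau^n:X\to X$ ($n\in\mathbb N^k$) such that for every $n$ the family $\{\tau_\lambda:d(\lambda)=n\}$ is a semibranching function system with coding map $\tau^n$; $\tau_v=\mathrm{id}$ on $D_v$ for every vertex $v$; whenever $s(\lambda)=r(\nu)$, $R_\nu\subseteq D_\lambda$ and $D_{\lambda\nu}=D_\nu$ up to null sets and $\tau_\lambda\tau_\nu=\tau_{\lambda\nu}$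 a.e.; and $\tau^m\circ\tau^n=\tau^{m+n}$. A *$\Lambda$-projective system* is such a system together with functions $f_\lambda\in L^2(X,\mu)$ satisfying $0\neq\frac{d(\mu\circ\tau_\lambda^{-1})}{d\mu}=|f_\lambda|^2$ for all $\lambda$, and $f_\lambda\cdot(f_\nu\circ\tau^{d(\lambda)})=f_{\lambda\nu}$ a.e. whenever $s(\lambda)=r(\nu)$. A representation of $C^*(\Lambda)$ on $L^2(X,\mu)$ *arises from* it if it sends each $s_\lambda$ to the operator $h\mapsto f_\lambda\cdot(h\circ\tau^{d(\lambda)})$. A $\Lambda$-projective system on $(\Lambda^\infty,\mu)$ is *associated to the standard coding and prefixing maps* if $D_\lambda=Z(s(\lambda))$, $\tau_\lambda=\sigma_\lambda$ and $\tau^n=\sigma^n$. **Theorem.** (1) Let $\pi$ be a monic representation of $C^*(\Lambda)$ on a Hilbert space $\mathcal H$ and let $\xi$ be a monic vector. Then the measure $\mu_\pi$ exists and is unique, and $\pi$ is unitarily equivalent to a representation of $C^*(\Lambda)$ on $L^2(\Lambda^\infty,\mu_\pi)$ that arises from a $\Lambda$-projective system on $(\Lambda^\infty,\mu_\pi)$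 associated to the standard coding and prefixing maps. (2) Conversely, let $\mu$ be a measure on $\Lambda^\infty$ with $\mu(Z(v))<\infty$ for every vertex $v$, and let $\pi$ be a representation of $C^*(\Lambda)$ on $L^2(\Lambda^\infty,\mu)$ that arises from a $\Lambda$-projective system on $(\Lambda^\infty,\mu)$ associated to the standard coding and prefixing maps. Then $\pi$ is monic, and for every monic vector the associated measure $\mu_\pi$ exists and is unique and $L^2(\Lambda^\infty,\mu)$ is isometrically isomorphic to $L^2(\Lambda^\infty,\mu_\pi)$. -/

import Mathlib

open CategoryTheory MeasureTheory
open scoped ENNReal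

universe u

attribute [-instance] CategoryTheory.catToReflQuiver

noncomputable section

/-! ### Higher-rank graphs -/

/-- A `k`-graph: a countable small category `V` (the type `V` is the set of vertices) with a degree
functor to `ℕ^k` satisfying the factorization property.  A morphism `f : w ⟶ v` is a path with
source `w` and range `v`; for `g : u ⟶ w` the path written `f g` in the `k`-graph literature is the
composite `g ≫ f`.  The set of all paths is `Arrow V`, so that for `l : Arrow V` the source of `l`
is `l.left` and the range of `l` is `l.right`. -/
structure KGraph (k : ℕ) (V : Type u) [SmallCategory V] where
  countable_arrow : Countable (Arrow V)
  deg : ∀ {w v : V}, (w ⟶ v) → (Fin k → ℕ)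
  deg_id : ∀ v : V, deg (𝟙 v) = 0
  deg_comp : ∀ {t w v : V} (g : t ⟶ w) (f : w ⟶ v), deg (g ≫ f) = deg f + deg g
  /-- If `deg f = m + n` then `f` factors uniquely as (a path of degree `m`) after (a path of
  degree `n`). -/
  factorization : ∀ {w v : V} (f : w ⟶ v) (m n : Fin k → ℕ), deg f = m + n →
    ∃! q : (Σ c : V, (w ⟶ c) × (c ⟶ v)),
      q.2.1 ≫ q.2.2 = f ∧ deg q.2.2 = m ∧ deg q.2.1 = n

namespace KGraph

variable {k : ℕ} {V : Type u} [SmallCategory V] (Λ : KGraph k V)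

/-- The degree of a path. -/
def degree (l : Arrow V) : Fin k → ℕ := Λ.deg l.hom

/-- The set `vΛⁿ` of paths with range `v` and degree `n`. -/
def pathsInto (v : V) (n : Fin k → ℕ) : Set (Arrow V) := {l | l.right = v ∧ Λ.degree l = n}

/-- `Λ` is row-finite: every `vΛⁿ` is finite. -/
def RowFinite : Prop := ∀ v n, (Λ.pathsInto v n).Finite

/-- `Λ` has no sources: every `vΛⁿ` is nonempty. -/
def SourceFree : Prop := ∀ v n, (Λ.pathsInto v n).Nonempty

/-! ### Infinite paths -/

/-- The category `Ω_k`: its objects are the elements of `ℕ^k`, with exactly one morphism `(p, q)`,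
of range `p` and source `q`, whenever `p ≤ q`. -/
structure Omega (k : ℕ) where
  pos : Fin k → ℕ

instance : SmallCategory (Omega k) where
  Hom q p := PLift (p.pos ≤ q.pos)
  id _ := ⟨le_rfl⟩
  comp f g := ⟨g.down.trans f.down⟩

/-- The morphism `(p, q)` of `Ω_k`. -/
def Omega.hom {p q : Fin k → ℕ} (h : p ≤ q) : Omega.mk q ⟶ Omega.mk p := ⟨h⟩

/-- An infinite path: a degree-preserving functor `Ω_k ⥤ Λ`. -/
structure InfinitePath where
  toFunctor : Omega k ⥤ V
  deg_map : ∀ {p q : Fin k → ℕ} (h : p ≤ q), Λ.deg (toFunctor.map (Omega.hom h)) = q - p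

variable {Λ}

theorem deg_eqToHom {v w : V} (h : v = w) : Λ.deg (eqToHom h) = 0 := by
  subst h; simpa using Λ.deg_id v

theorem factor_unique (Λ : KGraph k V) {w v c c' : V} {g : w ⟶ c} {f : c ⟶ v} {g' : w ⟶ c'} {f' : c' ⟶ v}
    (h : g ≫ f = g' ≫ f') (hd : Λ.deg f = Λ.deg f') :
    (⟨c, g, f⟩ : Σ c : V, (w ⟶ c) × (c ⟶ v)) = ⟨c', g', f'⟩ := by
  have hg : Λ.deg g = Λ.deg g' := by
    have := congrArg Λ.deg h
    rw [Λ.deg_comp, Λ.deg_comp, hd] at this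
    exact add_left_cancel this
  exact (Λ.factorization (g ≫ f) (Λ.deg f) (Λ.deg g) (Λ.deg_comp g f)).unique
    ⟨rfl, rfl, rfl⟩ ⟨h.symm, hd.symm, hg.symm⟩

theorem factor_cancel (Λ : KGraph k V) {w v c : V} {g g' : w ⟶ c} {f : c ⟶ v} (h : g ≫ f = g' ≫ f) : g = g' := by
  have := factor_unique Λ h rfl
  simpa using this

theorem exists_lift (Λ : KGraph k V) {a c d v : V} (u : a ⟶ c) (f : c ⟶ v) (u' : a ⟶ d)
    (f' : d ⟶ v) (h : u ≫ f = u' ≫ f') (hd : Λ.deg f ≤ Λ.deg f') : ∃ g : d ⟶ c, g ≫ f = f' := by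
  obtain ⟨⟨e, g, b⟩, ⟨h1, h2, -⟩, -⟩ := Λ.factorization f' (Λ.deg f) (Λ.deg f' - Λ.deg f)
    (add_tsub_cancel_of_le hd).symm
  dsimp only at h1 h2
  have key := factor_unique Λ (g := u) (f := f) (g' := u' ≫ g) (f' := b)
    (by rw [Category.assoc, h1, h]) h2.symm
  cases key
  exact ⟨g, h1⟩

namespace InfinitePath

/-- The finite segment `x(p, q)` of an infinite path. -/
def segment (x : Λ.InfinitePath) {p q : Fin k → ℕ} (h : p ≤ q) : Arrow V :=
  Arrow.mk (x.toFunctor.map (Omega.hom h))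

/-- The range `r(x) = x(0)` of an infinite path. -/
def range (x : Λ.InfinitePath) : V := x.toFunctor.obj (Omega.mk 0)

variable (Λ) in
/-- The cylinder set `Z(l) = {x | x(0, d(l)) = l}`. -/
def cylinder (l : Arrow V) : Set Λ.InfinitePath :=
  {x | x.segment (fun i => Nat.zero_le (Λ.degree l i)) = l}

variable (Λ) in
/-- The cylinder set `Z(v)` of a vertex. -/
def vertexCylinder (v : V) : Set Λ.InfinitePath := cylinder Λ (Arrow.mk (𝟙 v))

/-- The Borel structure of `Λ^∞`, generated by the cylinder sets. -/
instance : MeasurableSpace Λ.InfinitePath :=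
  MeasurableSpace.generateFrom (Set.range (cylinder Λ))

/-- The shift map `σᵐ`, `σᵐ(x)(p, q) = x(p + m, q + m)`. -/
def shift (m : Fin k → ℕ) (x : Λ.InfinitePath) : Λ.InfinitePath where
  toFunctor :=
    { obj := fun p => x.toFunctor.obj ⟨p.pos + m⟩
      map := fun g => x.toFunctor.map (Omega.hom (add_le_add_left g.down m))
      map_id := fun p => x.toFunctor.map_id ⟨p.pos + m⟩
      map_comp := fun g g' => x.toFunctor.map_comp (Omega.hom (add_le_add_left g.down m))
        (Omega.hom (add_le_add_left g'.down m)) }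
  deg_map {p q} h := by
    have := x.deg_map (add_le_add_left h m)
    rw [add_tsub_add_eq_tsub_right] at this
    exact this

section Prefixing

variable {w v : V} (f : w ⟶ v) (x : Λ.InfinitePath) (hx : x.toFunctor.obj (Omega.mk 0) = w)

/-- The finite path `f x(0, p)`, of degree `d(f) + p`. -/
def concat (p : Fin k → ℕ) : x.toFunctor.obj (Omega.mk p) ⟶ v :=
  x.toFunctor.map (Omega.hom (show (0 : Fin k → ℕ) ≤ p from fun i => Nat.zero_le (p i))) ≫
    eqToHom hx ≫ f

theorem deg_concat (p : Fin k → ℕ) : Λ.deg (concat f x hx p) = p + Λ.deg f := by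
  have := x.deg_map (show (0 : Fin k → ℕ) ≤ p from fun i => Nat.zero_le (p i))
  rw [concat, Λ.deg_comp, Λ.deg_comp, deg_eqToHom, this]
  simp [add_comm]

theorem map_concat {p q : Fin k → ℕ} (h : p ≤ q) :
    x.toFunctor.map (Omega.hom h) ≫ concat f x hx p = concat f x hx q := by
  rw [concat, concat, ← Category.assoc, ← x.toFunctor.map_comp]
  rfl

/-- The factorization of `f x(0, p)` as a path of degree `p` followed by one of degree `d(f)`. -/
def prefixFactor (p : Fin k → ℕ) :
    Σ c : V, (x.toFunctor.obj (Omega.mk p) ⟶ c) × (c ⟶ v) :=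
  (Λ.factorization (concat f x hx p) p (Λ.deg f) (deg_concat f x hx p)).choose

theorem prefixFactor_spec (p : Fin k → ℕ) :
    (prefixFactor f x hx p).2.1 ≫ (prefixFactor f x hx p).2.2 = concat f x hx p ∧
      Λ.deg (prefixFactor f x hx p).2.2 = p ∧ Λ.deg (prefixFactor f x hx p).2.1 = Λ.deg f :=
  (Λ.factorization (concat f x hx p) p (Λ.deg f) (deg_concat f x hx p)).choose_spec.1

/-- The vertex `(f x)(p)`. -/
def prefixObj (p : Fin k → ℕ) : V := (prefixFactor f x hx p).1

/-- The path `(f x)(0, p)`: the initial segment of degree `p` of `f x(0, p)`. -/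
def prefixHead (p : Fin k → ℕ) : prefixObj f x hx p ⟶ v := (prefixFactor f x hx p).2.2

theorem exists_prefixMap {p q : Fin k → ℕ} (h : p ≤ q) :
    ∃ g : prefixObj f x hx q ⟶ prefixObj f x hx p,
      g ≫ prefixHead f x hx p = prefixHead f x hx q := by
  obtain ⟨hp, hpd, -⟩ := prefixFactor_spec f x hx p
  obtain ⟨hq, hqd, -⟩ := prefixFactor_spec f x hx q
  refine exists_lift Λ (x.toFunctor.map (Omega.hom h) ≫ (prefixFactor f x hx p).2.1)
    (prefixFactor f x hx p).2.2 (prefixFactor f x hx q).2.1 (prefixFactor f x hx q).2.2 ?_ ?_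
  · rw [Category.assoc, hp, hq, map_concat]
  · rw [hpd, hqd]; exact h

/-- The path `(f x)(p, q)`: the `(p, q)`-segment of `f x(0, q)`. -/
def prefixSegment {p q : Fin k → ℕ} (h : p ≤ q) : prefixObj f x hx q ⟶ prefixObj f x hx p :=
  (exists_prefixMap f x hx h).choose

theorem prefixSegment_comp {p q : Fin k → ℕ} (h : p ≤ q) :
    prefixSegment f x hx h ≫ prefixHead f x hx p = prefixHead f x hx q :=
  (exists_prefixMap f x hx h).choose_spec

/-- The infinite path `f x` for a finite path `f` and an infinite path `x` with `r(x) = s(f)`. -/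
def prefixPath : Λ.InfinitePath where
  toFunctor :=
    { obj := fun p => prefixObj f x hx p.pos
      map := fun g => prefixSegment f x hx (g.down)
      map_id := fun p => factor_cancel Λ (f := prefixHead f x hx p.pos) (by
        rw [prefixSegment_comp, Category.id_comp])
      map_comp := fun {p q r} g g' => factor_cancel Λ (f := prefixHead f x hx r.pos) (by
        rw [Category.assoc, prefixSegment_comp, prefixSegment_comp, prefixSegment_comp]) }
  deg_map {p q} h := by
    have h1 := congrArg Λ.deg (prefixSegment_comp f x hx h)
    rw [Λ.deg_comp] at h1
    have h2 : Λ.deg (prefixHead f x hx p) = p := (prefixFactor_spec f x hx p).2.1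
    have h3 : Λ.deg (prefixHead f x hx q) = q := (prefixFactor_spec f x hx q).2.1
    rw [h2, h3] at h1
    exact eq_tsub_of_add_eq (by rw [add_comm]; exact h1)

end Prefixing

open Classical in
/-- The prefixing map `σ_l : Z(s(l)) → Z(l)`, `x ↦ l x`; it is extended to all of `Λ^∞` by the
identity, but only its values on `Z(s(l))` matter. -/
def prefixMap (l : Arrow V) (x : Λ.InfinitePath) : Λ.InfinitePath :=
  if hx : x.range = l.left then prefixPath l.hom x hx else x

end InfinitePath

end KGraph

/-! ### Semibranching function systems -/

/-- A semibranching function system `{τ i : D i → X}` on the measure space `(X, μ)`.  The map `τ i`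
is only used on `D i`.  In the last field `Φ` is the Radon-Nikodym derivative of the measure
`E ↦ μ (τ i '' E)` on `D i` with respect to `μ`. -/
structure IsSemibranching {X : Type*} [MeasurableSpace X] (μ : Measure X) {I : Type*}
    (D : I → Set X) (τ : I → X → X) : Prop where
  measurableSet_dom : ∀ i, MeasurableSet (D i)
  dom_pos : ∀ i, 0 < μ (D i)
  dom_lt_top : ∀ i, μ (D i) < ∞
  measurable_map : ∀ i, Measurable ((D i).domRestrict (τ i))
  measurableSet_range : ∀ i, MeasurableSet (τ i '' D i)
  range_cover : μ (⋃ i, τ i '' D i)ᶜ = 0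
  range_disjoint : ∀ i j, i ≠ j → μ (τ i '' D i ∩ τ j '' D j) = 0
  range_lt_top : ∀ i, μ (τ i '' D i) < ∞
  rnDeriv_pos : ∀ i, ∃ Φ : X → ℝ≥0∞, Measurable Φ ∧
    (∀ E, MeasurableSet E → E ⊆ D i → μ (τ i '' E) = ∫⁻ x in E, Φ x ∂μ) ∧
    ∀ᵐ x ∂μ.restrict (D i), 0 < Φ x

/-- `σ` is a coding map for the family `{τ i : D i → X}`. -/
structure IsCodingMap {X : Type*} [MeasurableSpace X] {I : Type*}
    (D : I → Set X) (τ : I → X → X) (σ : X → X) : Prop where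
  measurable : Measurable σ
  leftInvOn : ∀ i, Set.LeftInvOn σ (τ i) (D i)

namespace KGraph

variable {k : ℕ} {V : Type u} [SmallCategory V] (Λ : KGraph k V)

/-- A `Λ`-semibranching function system on `(X, μ)`, with prefixing maps `τ l : D l → X` and coding
maps `σ m : X → X`. -/
structure IsLambdaSemibranching {X : Type*} [MeasurableSpace X] (μ : Measure X)
    (D : Arrow V → Set X) (τ : Arrow V → X → X) (σ : (Fin k → ℕ) → X → X) : Prop where
  semibranching : ∀ m : Fin k → ℕ,
    IsSemibranching μ (fun l : {l : Arrow V // Λ.degree l = m} => D l) (fun l => τ l)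
  coding : ∀ m : Fin k → ℕ,
    IsCodingMap (fun l : {l : Arrow V // Λ.degree l = m} => D l) (fun l => τ l) (σ m)
  vertex : ∀ v : V, Set.EqOn (τ (Arrow.mk (𝟙 v))) id (D (Arrow.mk (𝟙 v)))
  range_subset : ∀ {t w v : V} (g : t ⟶ w) (f : w ⟶ v),
    μ ((τ (Arrow.mk g) '' D (Arrow.mk g)) \ D (Arrow.mk f)) = 0
  dom_comp : ∀ {t w v : V} (g : t ⟶ w) (f : w ⟶ v),
    D (Arrow.mk (g ≫ f)) =ᵐ[μ] D (Arrow.mk g)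
  comp : ∀ {t w v : V} (g : t ⟶ w) (f : w ⟶ v), ∀ᵐ x ∂μ.restrict (D (Arrow.mk g)),
    τ (Arrow.mk f) (τ (Arrow.mk g) x) = τ (Arrow.mk (g ≫ f)) x
  coding_add : ∀ m n : Fin k → ℕ, σ m ∘ σ n = σ (m + n)

/-- A `Λ`-projective system on `(X, μ)`: a `Λ`-semibranching function system together with functions
`F l ∈ L²(X, μ)` such that `|F l|²` is nonzero and is the Radon-Nikodym derivative of
`μ ∘ (τ l)⁻¹` with respect to `μ`, and `F f · (F g ∘ σ^{d(f)}) = F (f g)` for composable paths. -/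
structure IsLambdaProjective {X : Type*} [MeasurableSpace X] (μ : Measure X)
    (D : Arrow V → Set X) (τ : Arrow V → X → X) (σ : (Fin k → ℕ) → X → X)
    (F : Arrow V → Lp ℂ 2 μ) : Prop where
  isLambdaSemibranching : Λ.IsLambdaSemibranching μ D τ σ
  ne_zero : ∀ l, F l ≠ 0
  rnDeriv_eq : ∀ l, ∀ E : Set X, MeasurableSet E →
    μ (D l ∩ τ l ⁻¹' E) = ∫⁻ x in E, ‖F l x‖ₑ ^ 2 ∂μ
  mul_comp : ∀ {t w v : V} (g : t ⟶ w) (f : w ⟶ v),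
    (fun x => F (Arrow.mk f) x * F (Arrow.mk g) (σ (Λ.deg f) x)) =ᵐ[μ] F (Arrow.mk (g ≫ f))

/-- A `Λ`-projective system on `(Λ^∞, μ)` associated to the standard prefixing maps
`σ_l : Z(s(l)) → Z(l)` and the standard coding maps `σᵐ`. -/
def IsStandardProjective (μ : Measure Λ.InfinitePath) (F : Arrow V → Lp ℂ 2 μ) : Prop :=
  Λ.IsLambdaProjective μ (fun l => InfinitePath.vertexCylinder Λ l.left)
    InfinitePath.prefixMap InfinitePath.shift F

/-! ### Cuntz-Krieger families and the `C*`-algebra of a `k`-graph -/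

/-- A Cuntz-Krieger `Λ`-family. -/
structure IsCuntzKrieger {A : Type*} [NonUnitalRing A] [StarRing A] (t : Arrow V → A) : Prop where
  partialIsometry : ∀ l, t l * star (t l) * t l = t l
  vertex_proj : ∀ v : V, IsStarProjection (t (Arrow.mk (𝟙 v)))
  vertex_orth : ∀ v w : V, v ≠ w → t (Arrow.mk (𝟙 v)) * t (Arrow.mk (𝟙 w)) = 0
  mul : ∀ {b w v : V} (g : b ⟶ w) (f : w ⟶ v),
    t (Arrow.mk f) * t (Arrow.mk g) = t (Arrow.mk (g ≫ f))
  star_mul : ∀ l, star (t l) * t l = t (Arrow.mk (𝟙 l.left))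
  vertex_eq_sum : ∀ (v : V) (n : Fin k → ℕ),
    t (Arrow.mk (𝟙 v)) = ∑ᶠ l ∈ Λ.pathsInto v n, t l * star (t l)

/-- A `C*`-algebra with a Cuntz-Krieger `Λ`-family. -/
structure CKModel where
  carrier : Type u
  [inst : NonUnitalCStarAlgebra carrier]
  fam : Arrow V → carrier
  isCK : Λ.IsCuntzKrieger fam

attribute [instance] CKModel.inst

variable {Λ} in
theorem IsCuntzKrieger.norm_le_one {A : Type*} [NonUnitalCStarAlgebra A] {t : Arrow V → A}
    (h : Λ.IsCuntzKrieger t) (l : Arrow V) : ‖t l‖ ≤ 1 := by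
  have hp := h.vertex_proj l.left
  have h1 : ‖t l‖ * ‖t l‖ = ‖t (Arrow.mk (𝟙 l.left))‖ := by
    rw [← h.star_mul, CStarRing.norm_star_mul_self]
  have h2 : ‖t (Arrow.mk (𝟙 l.left))‖ =
      ‖t (Arrow.mk (𝟙 l.left))‖ * ‖t (Arrow.mk (𝟙 l.left))‖ := by
    have := CStarRing.norm_star_mul_self (x := t (Arrow.mk (𝟙 l.left)))
    rwa [hp.isSelfAdjoint.star_eq, hp.isIdempotentElem.eq] at this
  have h0 := norm_nonneg (t l)
  have h0' := norm_nonneg (t (Arrow.mk (𝟙 l.left)))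
  have h3 : ‖t (Arrow.mk (𝟙 l.left))‖ ≤ 1 := by
    by_contra! hc
    nlinarith
  nlinarith

/-- The family of all Cuntz-Krieger `Λ`-families. -/
def universalFam (l : Arrow V) : lp (fun M : Λ.CKModel => M.carrier) ∞ :=
  ⟨fun M => M.fam l, memℓp_infty ⟨1, by rintro _ ⟨M, rfl⟩; exact M.isCK.norm_le_one l⟩⟩

/-- The universal `C*`-algebra `C*(Λ)`, realised as the `C*`-subalgebra generated by the universal
family in the `ℓ^∞`-product of all `C*`-algebras carrying a Cuntz-Krieger `Λ`-family.  (A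
`C*`-algebra generated by such a family is separable, so restricting to one universe loses
nothing.) -/
def CStarSubalgebra : NonUnitalStarSubalgebra ℂ (lp (fun M : Λ.CKModel => M.carrier) ∞) :=
  (NonUnitalStarAlgebra.adjoin ℂ (Set.range Λ.universalFam)).topologicalClosure

/-- The `C*`-algebra `C*(Λ)`. -/
abbrev CStar : Type (u + 1) := Λ.CStarSubalgebra

/-- The generator `s_l` of `C*(Λ)`. -/
def gen (l : Arrow V) : Λ.CStar :=
  ⟨Λ.universalFam l, NonUnitalStarSubalgebra.le_topologicalClosure _
    (NonUnitalStarAlgebra.subset_adjoin ℂ _ ⟨l, rfl⟩)⟩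

/-- The generators of `C*(Λ)` form a Cuntz-Krieger `Λ`-family. -/
theorem isCuntzKrieger_gen (hfin : Λ.RowFinite) : Λ.IsCuntzKrieger Λ.gen where
  partialIsometry l := Subtype.ext <| Subtype.ext <| funext fun M => M.isCK.partialIsometry l
  vertex_proj v := ⟨Subtype.ext <| Subtype.ext <| funext fun M => (M.isCK.vertex_proj v).1,
    Subtype.ext <| Subtype.ext <| funext fun M => (M.isCK.vertex_proj v).2⟩
  vertex_orth v w h := Subtype.ext <| Subtype.ext <| funext fun M => M.isCK.vertex_orth v w h
  mul g f := Subtype.ext <| Subtype.ext <| funext fun M => M.isCK.mul g f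
  star_mul l := Subtype.ext <| Subtype.ext <| funext fun M => M.isCK.star_mul l
  vertex_eq_sum v n := by
    refine Subtype.ext <| Subtype.ext <| funext fun M => ?_
    let φ : Λ.CStar →+ M.carrier := ⟨⟨fun a => a.1 M, rfl⟩, fun _ _ => rfl⟩
    refine (M.isCK.vertex_eq_sum v n).trans ?_
    exact (φ.map_finsum_mem (fun l => Λ.gen l * star (Λ.gen l)) (hfin v n)).symm

/-- The universal property of `C*(Λ)`: every Cuntz-Krieger `Λ`-family in a `C*`-algebra is the image
of the generating family under a `*`-homomorphism. -/
theorem exists_hom_of_isCuntzKrieger {A : Type u} [NonUnitalCStarAlgebra A] {t : Arrow V → A}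
    (h : Λ.IsCuntzKrieger t) : ∃ φ : Λ.CStar →⋆ₙₐ[ℂ] A, ∀ l, φ (Λ.gen l) = t l :=
  ⟨{ toFun := fun a => a.1 ⟨A, t, h⟩
     map_smul' := fun _ _ => rfl
     map_zero' := rfl
     map_add' := fun _ _ => rfl
     map_mul' := fun _ _ => rfl
     map_star' := fun _ => rfl }, fun _ => rfl⟩

/-! ### Representations -/

section Representations

variable {Λ} {H : Type*} [NormedAddCommGroup H] [InnerProductSpace ℂ H] [CompleteSpace H]
  (π : Λ.CStar →⋆ₙₐ[ℂ] (H →L[ℂ] H))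

/-- `ξ` is a monic vector for `π`: with `t_l = π(s_l)`, the vectors `t_l t_l^* ξ` span a dense
subspace. -/
def IsMonicVector (ξ : H) : Prop :=
  (Submodule.span ℂ (Set.range fun l : Arrow V =>
    (π (Λ.gen l) * star (π (Λ.gen l))) ξ)).topologicalClosure = ⊤

/-- `π` is monic: every `t_l = π(s_l)` is nonzero and there is a monic vector. -/
def IsMonic : Prop := (∀ l, π (Λ.gen l) ≠ 0) ∧ ∃ ξ, IsMonicVector π ξ

/-- `μ` is the measure `μ_π` on `Λ^∞` associated to `π` and the vector `ξ`:
`μ(Z(l)) = ⟨ξ, t_l t_l^* ξ⟩` for all `l`. -/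
def IsMonicMeasure (ξ : H) (μ : Measure Λ.InfinitePath) : Prop :=
  ∀ l, μ (InfinitePath.cylinder Λ l) =
    ENNReal.ofReal (inner ℂ ξ ((π (Λ.gen l) * star (π (Λ.gen l))) ξ)).re

/-- Unitary equivalence of representations. -/
def UnitarilyEquivalent {K : Type*} [NormedAddCommGroup K] [InnerProductSpace ℂ K] [CompleteSpace K]
    (ρ : Λ.CStar →⋆ₙₐ[ℂ] (K →L[ℂ] K)) : Prop :=
  ∃ U : H ≃ₗᵢ[ℂ] K, ∀ (a : Λ.CStar) (h : H), U (π a h) = ρ a (U h)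

/-- `ρ` is the representation on `L²(Λ^∞, μ)` arising from the functions `F l`, the standard
prefixing maps and the standard coding maps: `ρ(s_l) h = F l · (h ∘ σ^{d(l)})`. -/
def ArisesFrom {μ : Measure Λ.InfinitePath} (F : Arrow V → Lp ℂ 2 μ)
    (ρ : Λ.CStar →⋆ₙₐ[ℂ] (Lp ℂ 2 μ →L[ℂ] Lp ℂ 2 μ)) : Prop :=
  ∀ (l : Arrow V) (h : Lp ℂ 2 μ),
    ρ (Λ.gen l) h =ᵐ[μ] fun x => F l x * h (InfinitePath.shift (Λ.degree l) x)

end Representations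

end KGraph

end

/-! Write `p_l = t_l t_l^*`. Everything rests on a match between these projections and cylinder
sets. An infinite path has one initial segment of each degree, so `Z(l) ∩ Z(m)` is the disjoint
union of the `Z(c)` over the finitely many common extensions `c` of degree `d(l) ∨ d(m)`
(`cylinder_inter_cylinder`). The Cuntz–Krieger relations give `p_l p_m = ∑ p_c` over the same `c`
(`proj_mul_proj`).

Hence the numbers `‖p_l ξ‖²` are consistent under extension of paths. They define a finitely
additive content on finite unions of cylinders, which compactness makes countably additive
(`exists_measure_cylinder`); uniqueness holds because vertex cylinders have finite measure. The
vectors `p_l ξ` and the functions `1_{Z(l)}` in `L²(μ_π)` then have the same Gram matrix, and both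
families are total when `ξ` is monic. So a unitary carries one to the other (`exists_unitary`), and
it turns `p_l` into multiplication by `1_{Z(l)}` (`conjRep_proj_eq_cylinderMul`).

For any representation `ρ` on `L²(μ)` with this last property, put `F_l = ρ(s_l) 1_{Z(s(l))}`. The
relation `s_l p_a = p_{la} s_l` says that `ρ(s_l)` sends `1_{Z(a)}` to `F_l · (1_{Z(a)} ∘
σ^{d(l)})`. Since `s_l` is isometric on its initial space, `|F_l|² μ` pushes forward under
`σ^{d(l)}` to `μ` restricted to `Z(s(l))` (`map_weightMeasure`). This yields boundedness of the
weighted composition operator, both Radon–Nikodym statements and, by density, the formula for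
`ρ(s_l)` on all of `L²`.

For the converse, `F_l` vanishes off `Z(l)`, so `p_l` is dominated by multiplication by `1_{Z(l)}`.
The projections of one degree and one range sum to a vertex projection, which forces equality
(`ArisesFrom.proj_eq_cylinderMul`). Any nowhere vanishing `L²` function is then a monic vector, and
the unitary above, applied to an arbitrary monic vector, gives the required isometry. -/

namespace KGraph

/-! ### Concatenation of finite paths -/

section Paths

variable {k : ℕ} {V : Type u} [SmallCategory V]

/-- `IsComp l a c`: the path `c` is the path `l` followed by the path `a`. -/
def IsComp (l a c : Arrow V) : Prop :=
  ∃ (t w v : V) (g : t ⟶ w) (f : w ⟶ v),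
    l = Arrow.mk f ∧ a = Arrow.mk g ∧ c = Arrow.mk (g ≫ f)

theorem isComp_mk {t w v : V} (g : t ⟶ w) (f : w ⟶ v) :
    IsComp (Arrow.mk f) (Arrow.mk g) (Arrow.mk (g ≫ f)) :=
  ⟨t, w, v, g, f, rfl, rfl, rfl⟩

/-- `l` is an initial segment of `c`. -/
def IsPrefix (l c : Arrow V) : Prop := ∃ a, IsComp l a c

namespace IsComp

variable {l a c : Arrow V}

theorem right_eq_left (h : IsComp l a c) : a.right = l.left := by
  obtain ⟨t, w, v, g, f, rfl, rfl, rfl⟩ := h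
  rfl

theorem right_eq (h : IsComp l a c) : c.right = l.right := by
  obtain ⟨t, w, v, g, f, rfl, rfl, rfl⟩ := h
  rfl

theorem degree_eq (h : IsComp l a c) (Λ : KGraph k V) :
    Λ.degree c = Λ.degree l + Λ.degree a := by
  obtain ⟨t, w, v, g, f, rfl, rfl, rfl⟩ := h
  exact Λ.deg_comp g f

theorem isPrefix (h : IsComp l a c) : IsPrefix l c := ⟨a, h⟩

/-- A witness of `IsComp` over a given first path. -/
theorem exists_hom (h : IsComp l a c) :
    ∃ (t : V) (g : t ⟶ l.left), a = Arrow.mk g ∧ c = Arrow.mk (g ≫ l.hom) := by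
  obtain ⟨t, w, v, g, f, rfl, rfl, rfl⟩ := h
  exact ⟨t, g, rfl, rfl⟩

theorem eq {c' : Arrow V} (h : IsComp l a c) (h' : IsComp l a c') : c = c' := by
  obtain ⟨t, w, v, g, f, rfl, rfl, rfl⟩ := h
  obtain ⟨t', g', h1, rfl⟩ := h'.exists_hom
  cases h1
  rfl

theorem unique {l' a' : Arrow V} (h : IsComp l a c) (h' : IsComp l' a' c) (Λ : KGraph k V)
    (hd : Λ.degree l = Λ.degree l') : l = l' ∧ a = a' := by
  obtain ⟨t, w, v, g, f, rfl, rfl, rfl⟩ := h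
  obtain ⟨t', w', v', g', f', rfl, rfl, h3⟩ := h'
  obtain rfl : t = t' := congrArg Comma.left h3
  obtain rfl : v = v' := congrArg Comma.right h3
  have h4 : g ≫ f = g' ≫ f' :=
    (Arrow.mk_inj _ _).1 h3
  have := factor_unique Λ h4 hd
  cases this
  exact ⟨rfl, rfl⟩

theorem assoc {b e : Arrow V} (h : IsComp l a c) (h' : IsComp c b e) :
    ∃ d, IsComp a b d ∧ IsComp l d e := by
  obtain ⟨t, w, v, g, f, rfl, rfl, rfl⟩ := h
  obtain ⟨s, j, rfl, rfl⟩ := h'.exists_hom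
  refine ⟨Arrow.mk (j ≫ g), isComp_mk j g, ?_⟩
  have := isComp_mk (j ≫ g) f
  rwa [Category.assoc] at this

theorem assoc' {b d : Arrow V} (h : IsComp l a c) (h' : IsComp a b d) :
    ∃ e, IsComp c b e ∧ IsComp l d e := by
  obtain ⟨t, w, v, g, f, rfl, rfl, rfl⟩ := h
  obtain ⟨s, j, rfl, rfl⟩ := h'.exists_hom
  refine ⟨Arrow.mk (j ≫ g ≫ f), isComp_mk j (g ≫ f), ?_⟩
  have := isComp_mk (j ≫ g) f
  rwa [Category.assoc] at this

/-- Associativity with all four composites given. -/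
theorem trans {b d e : Arrow V} (h : IsComp l a c) (h' : IsComp a b d) (h'' : IsComp l d e) :
    IsComp c b e := by
  obtain ⟨e', h1, h2⟩ := h.assoc' h'
  rwa [h''.eq h2]

end IsComp

theorem exists_isComp {l a : Arrow V} (h : a.right = l.left) : ∃ c, IsComp l a c :=
  ⟨_, _, _, _, a.hom ≫ eqToHom h, l.hom, rfl, by
    cases a; cases l; cases h; simp; rfl, rfl⟩

theorem isComp_id_right (l : Arrow V) : IsComp l (Arrow.mk (𝟙 l.left)) l :=
  ⟨_, _, _, 𝟙 l.left, l.hom, rfl, rfl, by simp⟩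

theorem isComp_id_left (l : Arrow V) : IsComp (Arrow.mk (𝟙 l.right)) l l :=
  ⟨_, _, _, l.hom, 𝟙 l.right, rfl, rfl, by simp⟩

theorem IsPrefix.refl (l : Arrow V) : IsPrefix l l := ⟨_, isComp_id_right l⟩

theorem IsPrefix.trans {a b c : Arrow V} (h : IsPrefix a b) (h' : IsPrefix b c) :
    IsPrefix a c := by
  obtain ⟨x, hx⟩ := h
  obtain ⟨y, hy⟩ := h'
  obtain ⟨d, -, hd⟩ := hx.assoc hy
  exact hd.isPrefix

theorem IsPrefix.right_eq {a b : Arrow V} (h : IsPrefix a b) : b.right = a.right := by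
  obtain ⟨x, hx⟩ := h
  exact hx.right_eq

variable (Λ : KGraph k V)

theorem IsPrefix.degree_le {a b : Arrow V} (h : IsPrefix a b) : Λ.degree a ≤ Λ.degree b := by
  obtain ⟨x, hx⟩ := h
  rw [hx.degree_eq Λ]
  exact le_self_add

theorem IsPrefix.eq_of_degree_eq {a b c : Arrow V} (ha : IsPrefix a c) (hb : IsPrefix b c)
    (h : Λ.degree a = Λ.degree b) : a = b := by
  obtain ⟨x, hx⟩ := ha
  obtain ⟨y, hy⟩ := hb
  exact (hx.unique hy Λ h).1

theorem degree_id (v : V) : Λ.degree (Arrow.mk (𝟙 v)) = 0 := Λ.deg_id v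

theorem exists_isComp_of_degree {c : Arrow V} {m n : Fin k → ℕ} (h : Λ.degree c = m + n) :
    ∃ l a, IsComp l a c ∧ Λ.degree l = m ∧ Λ.degree a = n := by
  obtain ⟨⟨w, g, f⟩, ⟨h1, h2, h3⟩, -⟩ := Λ.factorization c.hom m n h
  exact ⟨Arrow.mk f, Arrow.mk g, ⟨_, _, _, g, f, rfl, rfl, by rw [h1]; rfl⟩, h2, h3⟩

theorem exists_isPrefix {c : Arrow V} {p : Fin k → ℕ} (h : p ≤ Λ.degree c) :
    ∃ a, IsPrefix a c ∧ Λ.degree a = p := by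
  obtain ⟨l, a, h1, h2, -⟩ := Λ.exists_isComp_of_degree (c := c) (m := p)
    (n := Λ.degree c - p) (add_tsub_cancel_of_le h).symm
  exact ⟨l, h1.isPrefix, h2⟩

/-- `a` factors as `a` followed by an identity and as an identity followed by `a`; in degree zero
uniqueness of factorization identifies the two first factors. -/
theorem eq_id_of_degree_eq_zero {a : Arrow V} (h : Λ.degree a = 0) :
    a = Arrow.mk (𝟙 a.right) :=
  ((isComp_id_right a).unique (isComp_id_left a) Λ (by rw [h, Λ.degree_id])).1

theorem IsComp.eq_of_degree_eq_zero {a b c : Arrow V} (h : IsComp a b c)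
    (h0 : Λ.degree a = 0) : b = c := by
  have h1 := isComp_id_left c
  rw [h.right_eq, ← Λ.eq_id_of_degree_eq_zero h0] at h1
  exact (h.unique h1 Λ rfl).2

open Classical in
/-- The initial segment of degree `p` of a path of degree at least `p`. -/
noncomputable def head (p : Fin k → ℕ) (c : Arrow V) : Arrow V :=
  -- The value on paths that are too short is a default; totality lets `head` serve as the bonding
  -- map of an inverse system.
  if h : p ≤ Λ.degree c then (Λ.exists_isPrefix h).choose else c

variable {Λ} in
theorem head_isPrefix {p : Fin k → ℕ} {c : Arrow V} (h : p ≤ Λ.degree c) :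
    IsPrefix (Λ.head p c) c := by
  rw [head, dif_pos h]
  exact (Λ.exists_isPrefix h).choose_spec.1

variable {Λ} in
theorem degree_head {p : Fin k → ℕ} {c : Arrow V} (h : p ≤ Λ.degree c) :
    Λ.degree (Λ.head p c) = p := by
  rw [head, dif_pos h]
  exact (Λ.exists_isPrefix h).choose_spec.2

variable {Λ} in
theorem IsPrefix.head_eq {a c : Arrow V} (h : IsPrefix a c) : Λ.head (Λ.degree a) c = a :=
  (head_isPrefix (h.degree_le Λ)).eq_of_degree_eq Λ h (degree_head (h.degree_le Λ))

/-- The extensions of `l` of degree `q`. -/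
def extensions (l : Arrow V) (q : Fin k → ℕ) : Set (Arrow V) :=
  {c | IsPrefix l c ∧ Λ.degree c = q}

variable {Λ} in
theorem RowFinite.finite_extensions (hfin : Λ.RowFinite) (l : Arrow V) (q : Fin k → ℕ) :
    (Λ.extensions l q).Finite :=
  (hfin l.right q).subset fun _ hc => ⟨hc.1.right_eq, hc.2⟩

end Paths

namespace InfinitePath

variable {k : ℕ} {V : Type u} [SmallCategory V] {Λ : KGraph k V}

/-! ### Initial segments of infinite paths -/

/-- The initial segment `x(0, p)`. -/
def seg (x : Λ.InfinitePath) (p : Fin k → ℕ) : Arrow V :=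
  x.segment (show (0 : Fin k → ℕ) ≤ p from fun i => Nat.zero_le (p i))

theorem isComp_segment (x : Λ.InfinitePath) {p q r : Fin k → ℕ} (h : p ≤ q) (h' : q ≤ r) :
    IsComp (x.segment h) (x.segment h') (x.segment (h.trans h')) := by
  have := isComp_mk (x.toFunctor.map (Omega.hom h')) (x.toFunctor.map (Omega.hom h))
  rwa [← x.toFunctor.map_comp] at this

theorem degree_segment (x : Λ.InfinitePath) {p q : Fin k → ℕ} (h : p ≤ q) :
    Λ.degree (x.segment h) = q - p := x.deg_map h

theorem degree_seg (x : Λ.InfinitePath) (p : Fin k → ℕ) : Λ.degree (x.seg p) = p := by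
  rw [seg, degree_segment, tsub_zero]

theorem seg_right (x : Λ.InfinitePath) (p : Fin k → ℕ) : (x.seg p).right = x.range := rfl

theorem isComp_seg (x : Λ.InfinitePath) {p q : Fin k → ℕ} (h : p ≤ q) :
    IsComp (x.seg p) (x.segment h) (x.seg q) := isComp_segment x _ h

theorem seg_isPrefix (x : Λ.InfinitePath) {p q : Fin k → ℕ} (h : p ≤ q) :
    IsPrefix (x.seg p) (x.seg q) := (x.isComp_seg h).isPrefix

theorem seg_zero (x : Λ.InfinitePath) : x.seg 0 = Arrow.mk (𝟙 x.range) :=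
  Λ.eq_id_of_degree_eq_zero (x.degree_seg 0)

theorem mem_cylinder {x : Λ.InfinitePath} {l : Arrow V} :
    x ∈ cylinder Λ l ↔ x.seg (Λ.degree l) = l := Iff.rfl

theorem mem_cylinder_iff_isPrefix {x : Λ.InfinitePath} {l : Arrow V} {q : Fin k → ℕ}
    (h : Λ.degree l ≤ q) : x ∈ cylinder Λ l ↔ IsPrefix l (x.seg q) := by
  rw [mem_cylinder]
  constructor
  · intro h1
    rw [← h1]
    exact x.seg_isPrefix h
  · intro h1
    exact (x.seg_isPrefix h).eq_of_degree_eq Λ h1 (x.degree_seg _)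

theorem mem_vertexCylinder {x : Λ.InfinitePath} {v : V} :
    x ∈ vertexCylinder Λ v ↔ x.range = v := by
  rw [vertexCylinder, mem_cylinder, Λ.degree_id, seg_zero]
  constructor
  · intro h; exact congrArg Comma.right h
  · rintro rfl; rfl

theorem mem_cylinder_seg (x : Λ.InfinitePath) (p : Fin k → ℕ) : x ∈ cylinder Λ (x.seg p) := by
  rw [mem_cylinder, degree_seg]

theorem range_eq_of_mem_cylinder {x : Λ.InfinitePath} {l : Arrow V} (h : x ∈ cylinder Λ l) :
    x.range = l.right := by
  rw [mem_cylinder] at h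
  rw [← h]
  rfl

theorem cylinder_subset_vertexCylinder (l : Arrow V) :
    cylinder Λ l ⊆ vertexCylinder Λ l.right := fun _ hx =>
  mem_vertexCylinder.2 (range_eq_of_mem_cylinder hx)

/-- The segment `x(p, q)` is recovered from `x(0, p)` and `x(0, q)` by unique factorization. -/
theorem ext_of_seg {x y : Λ.InfinitePath} (h : ∀ p, x.seg p = y.seg p) : x = y := by
  have key : x.toFunctor = y.toFunctor := by
    refine Arrow.functor_ext fun q p g => ?_
    have h1 := x.isComp_seg g.down
    have h2 := y.isComp_seg g.down
    rw [h, h] at h1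
    exact (h1.unique h2 Λ rfl).2
  cases x; cases y; cases key; rfl

theorem seg_eq_of_le {x y : Λ.InfinitePath} {p q : Fin k → ℕ} (hpq : p ≤ q)
    (h : x.seg q = y.seg q) : x.seg p = y.seg p :=
  (x.seg_isPrefix hpq).eq_of_degree_eq Λ (h ▸ y.seg_isPrefix hpq)
    (by rw [degree_seg, degree_seg])

/-- A coherent family of finite paths is the family of initial segments of an infinite path. -/
theorem exists_of_coherent (A : (Fin k → ℕ) → Arrow V) (hd : ∀ p, Λ.degree (A p) = p)
    (hA : ∀ p q, p ≤ q → IsPrefix (A p) (A q)) : ∃ x : Λ.InfinitePath, ∀ p, x.seg p = A p := by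
  have hv : ∀ p, ∃ (o : V) (f : o ⟶ (A 0).right), A p = Arrow.mk f := fun p => by
    rw [← (hA 0 p fun i => Nat.zero_le _).right_eq]
    exact ⟨_, (A p).hom, rfl⟩
  choose o f hf using hv
  -- The connecting path is taken as a function of the proof of `p ≤ q`, so that `choose` applies to
  -- all pairs. Functoriality then follows by cancelling `f p`.
  have hg : ∀ p q, ∃ g : p ≤ q → (o q ⟶ o p), ∀ h, g h ≫ f p = f q := by
    intro p q
    by_cases h : p ≤ q
    · obtain ⟨a, ha⟩ := hA p q h
      rw [hf p, hf q] at ha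
      obtain ⟨t, g, rfl, h2⟩ := ha.exists_hom
      obtain rfl : o q = t := congrArg Comma.left h2
      exact ⟨fun _ => g, fun _ => ((Arrow.mk_inj _ _).1 h2).symm⟩
    · exact ⟨fun h' => absurd h' h, fun h' => absurd h' h⟩
  choose G hG using hg
  have hdf : ∀ p, Λ.deg (f p) = p := fun p => by
    have := hd p
    rwa [hf p] at this
  let x : Λ.InfinitePath :=
    { toFunctor :=
      { obj := fun p => o p.pos
        map := fun {q p} g => G p.pos q.pos g.down
        map_id := fun p => factor_cancel Λ (f := f p.pos) (by
          rw [hG, Category.id_comp])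
        map_comp := fun {p q r} g g' => factor_cancel Λ (f := f r.pos) (by
          rw [Category.assoc, hG, hG, hG]) }
      deg_map := fun {p q} h => by
        have h1 := congrArg Λ.deg (hG p q h)
        rw [Λ.deg_comp, hdf, hdf] at h1
        exact eq_tsub_of_add_eq (by rw [add_comm]; exact h1) }
  refine ⟨x, fun p => ?_⟩
  -- The path `A 0` has degree `0` but is not syntactically an identity: `x` starts at `o 0` rather
  -- than at the range of `A 0`, and the two are reconciled by the degree.
  have h2 := isComp_mk (G 0 p fun i => Nat.zero_le _) (f 0)
  rw [hG 0 p, ← hf 0, ← hf p] at h2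
  exact h2.eq_of_degree_eq_zero Λ (hd 0)

/-! ### Shifts and prefixing -/

theorem isComp_shift (x : Λ.InfinitePath) (m p : Fin k → ℕ) :
    IsComp (x.seg m) ((x.shift m).seg p) (x.seg (m + p)) := by
  have h1 := x.isComp_seg (le_add_of_nonneg_right (fun i => Nat.zero_le (p i)) : m ≤ m + p)
  have h3 : ∀ (a b c d : Fin k → ℕ) (hab : a ≤ b) (hac : c ≤ d), a = c → b = d →
      x.segment hab = x.segment hac := by
    rintro a b _ _ _ _ rfl rfl; rfl
  have h4 : (x.shift m).seg p =
      x.segment (le_add_of_nonneg_right (fun i => Nat.zero_le (p i)) : m ≤ m + p) :=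
    h3 (0 + m) (p + m) _ _ _ _ (zero_add m) (add_comm p m)
  rw [h4]
  exact h1

theorem range_shift (x : Λ.InfinitePath) (m : Fin k → ℕ) :
    (x.shift m).range = (x.seg m).left := by
  rw [← (x.isComp_shift m 0).right_eq_left, seg_right]

theorem shift_zero (x : Λ.InfinitePath) : x.shift 0 = x := by
  refine ext_of_seg fun p => ?_
  have h1 := x.isComp_shift 0 p
  have h2 := isComp_id_left (x.seg p)
  rw [zero_add, seg_zero] at h1
  exact (h1.unique h2 Λ rfl).2

theorem shift_shift (x : Λ.InfinitePath) (m n : Fin k → ℕ) :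
    (x.shift n).shift m = x.shift (m + n) := by
  refine ext_of_seg fun p => ?_
  have h1 := x.isComp_shift n (m + p)
  have h2 := (x.shift n).isComp_shift m p
  have h3 := x.isComp_shift n m
  have h4 := x.isComp_shift (m + n) p
  have h5 := h3.trans h2 h1
  rw [← add_assoc, add_comm n m] at h5
  exact (h5.unique h4 Λ rfl).2

theorem prefixMap_eq {l : Arrow V} {x : Λ.InfinitePath} (hx : x.range = l.left) :
    prefixMap l x = prefixPath l.hom x hx := dif_pos hx

theorem seg_prefixPath {w v : V} (f : w ⟶ v) (x : Λ.InfinitePath)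
    (hx : x.toFunctor.obj (Omega.mk 0) = w) (q : Fin k → ℕ) :
    (prefixPath f x hx).seg q = Arrow.mk (prefixHead f x hx q) := by
  have h1 := isComp_mk (prefixSegment f x hx (p := 0) (q := q) fun i => Nat.zero_le _)
    (prefixHead f x hx 0)
  rw [prefixSegment_comp] at h1
  exact h1.eq_of_degree_eq_zero Λ (prefixFactor_spec f x hx 0).2.1

theorem isComp_concat {l : Arrow V} {x : Λ.InfinitePath} (hx : x.range = l.left)
    (q : Fin k → ℕ) : IsComp l (x.seg q) (Arrow.mk (concat l.hom x hx q)) := by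
  refine ⟨_, _, _, x.toFunctor.map (Omega.hom fun i => Nat.zero_le _) ≫ eqToHom hx, l.hom,
    rfl, ?_, congrArg Arrow.mk (Category.assoc _ _ _).symm⟩
  have : ∀ {a b c : V} (g : a ⟶ b) (h : b = c), Arrow.mk g = Arrow.mk (g ≫ eqToHom h) := by
    rintro a b _ g rfl
    rw [eqToHom_refl, Category.comp_id]
  exact this _ hx

/-- `l x` is defined by cutting the overlong path `l x(0, q)` back to degree `q`. For `q = d(l) + p`
both the result of the cut and `l x(0, p)` are prefixes of that path of the same degree, hence
equal. -/
theorem isComp_prefixMap {l : Arrow V} {x : Λ.InfinitePath} (hx : x.range = l.left)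
    (p : Fin k → ℕ) : IsComp l (x.seg p) ((prefixMap l x).seg (Λ.degree l + p)) := by
  rw [prefixMap_eq hx, show (prefixPath l.hom x hx).seg (Λ.degree l + p) =
    Arrow.mk (prefixHead l.hom x hx (Λ.degree l + p)) from seg_prefixPath _ _ _ _]
  obtain ⟨h1, h2, -⟩ := prefixFactor_spec l.hom x hx (Λ.degree l + p)
  have h3 := isComp_mk (prefixFactor l.hom x hx (Λ.degree l + p)).2.1
    (prefixFactor l.hom x hx (Λ.degree l + p)).2.2
  rw [h1] at h3
  obtain ⟨c, hc⟩ := exists_isComp (l := l) (a := x.seg p) hx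
  obtain ⟨e, he1, he2⟩ := hc.assoc' (x.isComp_seg (le_add_self : p ≤ Λ.degree l + p))
  have h4 : IsPrefix c (Arrow.mk (concat l.hom x hx (Λ.degree l + p))) := by
    rw [(isComp_concat hx _).eq he2]
    exact he1.isPrefix
  have h5 := h4.eq_of_degree_eq Λ h3.isPrefix
    (by rw [hc.degree_eq Λ, degree_seg]; exact h2.symm)
  rw [h5] at hc
  exact hc

theorem range_prefixMap {l : Arrow V} {x : Λ.InfinitePath} (hx : x.range = l.left) :
    (prefixMap l x).range = l.right := by
  rw [← seg_right _ (Λ.degree l + 0), (isComp_prefixMap hx 0).right_eq]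

theorem prefixMap_mem_cylinder {l : Arrow V} {x : Λ.InfinitePath} (hx : x.range = l.left) :
    prefixMap l x ∈ cylinder Λ l :=
  (mem_cylinder_iff_isPrefix (le_add_of_nonneg_right fun _ => Nat.zero_le _)).2
    (isComp_prefixMap hx 0).isPrefix

theorem shift_prefixMap {l : Arrow V} {x : Λ.InfinitePath} (hx : x.range = l.left) :
    (prefixMap l x).shift (Λ.degree l) = x := by
  refine ext_of_seg fun p => ?_
  exact ((isComp_shift _ _ p).unique (isComp_prefixMap hx p) Λ (degree_seg _ _)).2

theorem range_shift_of_mem_cylinder {l : Arrow V} {x : Λ.InfinitePath}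
    (hx : x ∈ cylinder Λ l) : (x.shift (Λ.degree l)).range = l.left := by
  rw [range_shift, mem_cylinder.1 hx]

/-- The degrees `d(l) + p` are cofinal, and a segment determines all shorter ones. -/
theorem eq_prefixMap_of_isComp {l : Arrow V} {x y : Λ.InfinitePath}
    (h : ∀ p, IsComp l (x.seg p) (y.seg (Λ.degree l + p))) : y = prefixMap l x := by
  have hx : x.range = l.left := (h 0).right_eq_left
  refine ext_of_seg fun p => ?_
  exact seg_eq_of_le le_add_self ((h p).eq (isComp_prefixMap hx p))

theorem prefixMap_shift {l : Arrow V} {x : Λ.InfinitePath} (hx : x ∈ cylinder Λ l) :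
    prefixMap l (x.shift (Λ.degree l)) = x :=
  (eq_prefixMap_of_isComp fun p => by
    have := x.isComp_shift (Λ.degree l) p
    rwa [mem_cylinder.1 hx] at this).symm

theorem prefixMap_prefixMap {l a c : Arrow V} (h : IsComp l a c) {x : Λ.InfinitePath}
    (hx : x.range = a.left) : prefixMap l (prefixMap a x) = prefixMap c x := by
  have h1 : (prefixMap a x).range = l.left := by rw [range_prefixMap hx, h.right_eq_left]
  refine (eq_prefixMap_of_isComp fun p => ?_)
  have h2 := isComp_prefixMap h1 (Λ.degree a + p)
  rw [h.degree_eq Λ, add_assoc]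
  exact h.trans (isComp_prefixMap hx p) h2

theorem prefixMap_id {v : V} {x : Λ.InfinitePath} (hx : x.range = v) :
    prefixMap (Arrow.mk (𝟙 v)) x = x := by
  refine (eq_prefixMap_of_isComp fun p => ?_).symm
  subst hx
  rw [Λ.degree_id, zero_add]
  exact isComp_id_left (x.seg p)

theorem image_prefixMap (l : Arrow V) :
    prefixMap l '' vertexCylinder Λ l.left = cylinder Λ l := by
  ext y
  constructor
  · rintro ⟨x, hx, rfl⟩
    exact prefixMap_mem_cylinder (mem_vertexCylinder.1 hx)
  · intro hy
    exact ⟨y.shift (Λ.degree l), mem_vertexCylinder.2 (range_shift_of_mem_cylinder hy),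
      prefixMap_shift hy⟩

/-- For `x ∈ Z(l)`: `σ^{d(l)}(x) ∈ Z(a)` if and only if `x ∈ Z(l a)`. -/
theorem shift_mem_cylinder_iff {l a c : Arrow V} (h : IsComp l a c) {x : Λ.InfinitePath}
    (hx : x ∈ cylinder Λ l) : x.shift (Λ.degree l) ∈ cylinder Λ a ↔ x ∈ cylinder Λ c := by
  have h1 := x.isComp_shift (Λ.degree l) (Λ.degree a)
  rw [mem_cylinder.1 hx, ← h.degree_eq Λ] at h1
  rw [mem_cylinder, mem_cylinder]
  constructor
  · intro h2
    rw [h2] at h1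
    exact h1.eq h
  · intro h2
    rw [h2] at h1
    exact (h1.unique h Λ rfl).2

theorem cylinder_subset_of_isPrefix {a b : Arrow V} (h : IsPrefix a b) :
    cylinder Λ b ⊆ cylinder Λ a := fun x hx => by
  rw [mem_cylinder_iff_isPrefix (h.degree_le Λ), mem_cylinder.1 hx]
  exact h

theorem eq_of_mem_cylinder {x : Λ.InfinitePath} {a b : Arrow V} (ha : x ∈ cylinder Λ a)
    (hb : x ∈ cylinder Λ b) (h : Λ.degree a = Λ.degree b) : a = b := by
  rw [← mem_cylinder.1 ha, ← mem_cylinder.1 hb, h]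

/-! ### Compactness -/

/-- An inverse system of finite nonempty sets has a coherent family of elements. -/
theorem exists_coherent_of_finite {J : Type*} {α : Type*} [Preorder J] [IsDirectedOrder J]
    (G : J → Set α) (hfin : ∀ p, (G p).Finite) (hne : ∀ p, (G p).Nonempty) (r : J → α → α)
    (hr : ∀ p q, p ≤ q → ∀ c ∈ G q, r p c ∈ G p) (hid : ∀ p, ∀ c ∈ G p, r p c = c)
    (hcomp : ∀ p q s, p ≤ q → q ≤ s → ∀ c ∈ G s, r p (r q c) = r p c) :
    ∃ s : J → α, (∀ p, s p ∈ G p) ∧ ∀ p q, p ≤ q → r p (s q) = s p := by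
  let F : Jᵒᵖ ⥤ Type _ :=
    { obj := fun p => G p.unop
      map := fun {q p} f => TypeCat.ofHom fun c : G q.unop =>
        (⟨r p.unop c, hr _ _ (leOfHom f.unop) c c.2⟩ : G p.unop)
      map_id := fun p => by
        ext c
        exact hid _ c.1 c.2
      map_comp := fun {a b c} f g => by
        ext d
        exact (hcomp _ _ _ (leOfHom g.unop) (leOfHom f.unop) d.1 d.2).symm }
  have : ∀ p, Finite (F.obj p) := fun p => (hfin p.unop).to_subtype
  have : ∀ p, Nonempty (F.obj p) := fun p => (hne p.unop).to_subtype
  obtain ⟨s, hs⟩ := nonempty_sections_of_finite_inverse_system F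
  exact ⟨fun p => (s (Opposite.op p)).1, fun p => (s (Opposite.op p)).2, fun p q h =>
    congrArg Subtype.val (hs (homOfLE h).op)⟩

/-- König's lemma. -/
theorem exists_seg_mem (G : (Fin k → ℕ) → Set (Arrow V)) (hfin : ∀ p, (G p).Finite)
    (hne : ∀ p, (G p).Nonempty) (hdeg : ∀ p, ∀ c ∈ G p, Λ.degree c = p)
    (hhead : ∀ p q, p ≤ q → ∀ c ∈ G q, Λ.head p c ∈ G p) :
    ∃ x : Λ.InfinitePath, ∀ p, x.seg p ∈ G p := by
  have key : ∀ p q, p ≤ q → ∀ c ∈ G q, ∀ a, IsPrefix a c → Λ.degree a = p →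
      Λ.head p c = a := by
    rintro p q h c hc a ha rfl
    exact ha.head_eq
  obtain ⟨s, hs, hs'⟩ := exists_coherent_of_finite G hfin hne Λ.head hhead
    (fun p c hc => key p p le_rfl c hc c (IsPrefix.refl c) (hdeg p c hc))
    (fun p q r hpq hqr c hc => by
      have h1 : q ≤ Λ.degree c := by rw [hdeg r c hc]; exact hqr
      have h2 : p ≤ Λ.degree (Λ.head q c) := by rw [degree_head h1]; exact hpq
      exact (key p r (hpq.trans hqr) c hc _ ((head_isPrefix h2).trans (head_isPrefix h1))
        (degree_head h2)).symm)
  obtain ⟨x, hx⟩ := exists_of_coherent (Λ := Λ) s (fun p => hdeg p _ (hs p)) (fun p q h => by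
    rw [← hs' p q h]
    exact head_isPrefix (by rw [hdeg q _ (hs q)]; exact h))
  exact ⟨x, fun p => by rw [hx]; exact hs p⟩

/-- The sets `vΛᵖ` with `v = s(l)` are finite and nonempty, so König's lemma gives an infinite path
from `v`, to which `l` is prefixed. -/
theorem nonempty_cylinder (hfin : Λ.RowFinite) (hsrc : Λ.SourceFree) (l : Arrow V) :
    (cylinder Λ l).Nonempty := by
  obtain ⟨x, hx⟩ := exists_seg_mem (Λ := Λ) (fun p => Λ.pathsInto l.left p)
    (fun p => hfin _ _) (fun p => hsrc _ _) (fun p c hc => hc.2) (fun p q h c hc => by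
      have hp : p ≤ Λ.degree c := by rw [hc.2]; exact h
      exact ⟨by rw [← (head_isPrefix hp).right_eq, hc.1], degree_head hp⟩)
  exact ⟨prefixMap l x, prefixMap_mem_cylinder (hx 0).1⟩

/-- A decreasing sequence of nonempty sets, each determined by finitely many finite paths, has
nonempty intersection. -/
theorem nonempty_iInter_of_antitone (hfin : Λ.RowFinite) (A : ℕ → Set Λ.InfinitePath)
    (hA : ∀ i, ∃ (p : Fin k → ℕ) (S : Set (Arrow V)), S.Finite ∧ A i = {x | x.seg p ∈ S})
    (hanti : Antitone A) (hne : ∀ i, (A i).Nonempty) : (⋂ i, A i).Nonempty := by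
  -- The inverse system consists of the paths of degree `p` that occur as initial segments in every
  -- `A i`.
  have key : ∃ x : Λ.InfinitePath, ∀ p, x.seg p ∈ {c | ∀ i, ∃ x ∈ A i, x.seg p = c} := by
    refine exists_seg_mem (fun p => {c | ∀ i, ∃ x ∈ A i, x.seg p = c}) ?_ ?_ ?_ ?_
    · intro p
      obtain ⟨q, S, hS, h1⟩ := hA 0
      refine Set.Finite.subset (hS.biUnion fun c _ => hfin c.right p) fun c hc => ?_
      obtain ⟨x, hx, rfl⟩ := hc 0
      rw [h1] at hx
      exact Set.mem_biUnion hx ⟨by rw [seg_right, seg_right], x.degree_seg p⟩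
    · intro p
      choose x hx using hne
      obtain ⟨q, S, hS, h1⟩ := hA 0
      have hT : (⋃ c ∈ S, Λ.pathsInto c.right p).Finite := hS.biUnion fun c _ => hfin c.right p
      have hm : ∀ i, (x i).seg p ∈ ⋃ c ∈ S, Λ.pathsInto c.right p := fun i => by
        have := hanti (Nat.zero_le i) (hx i)
        rw [h1] at this
        exact Set.mem_biUnion this ⟨by rw [seg_right, seg_right], (x i).degree_seg p⟩
      have := hT.to_subtype
      obtain ⟨c, hc⟩ := Finite.exists_infinite_fiber
        (fun i => (⟨(x i).seg p, hm i⟩ : ↥(⋃ c ∈ S, Λ.pathsInto c.right p)))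
      refine ⟨c, fun i => ?_⟩
      obtain ⟨j, hj, hij⟩ := (Set.infinite_coe_iff.1 hc).exists_gt i
      exact ⟨x j, hanti hij.le (hx j), congrArg Subtype.val hj⟩
    · intro p c hc
      obtain ⟨x, -, rfl⟩ := hc 0
      exact x.degree_seg p
    · intro p q h c hc i
      obtain ⟨x, hx, rfl⟩ := hc i
      have := (x.seg_isPrefix h).head_eq (Λ := Λ)
      rw [degree_seg] at this
      exact ⟨x, hx, this.symm⟩
  obtain ⟨x, hx⟩ := key
  refine ⟨x, Set.mem_iInter.2 fun i => ?_⟩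
  obtain ⟨p, S, -, h1⟩ := hA i
  -- Membership in `A i` depends only on the segment of degree `p`, which `x` shares with a member
  -- of `A i`.
  obtain ⟨y, hy, hyx⟩ := hx p i
  rw [h1] at hy ⊢
  change x.seg p ∈ S
  rwa [← hyx]

/-! ### Measurability -/

theorem countable_vertices (Λ : KGraph k V) : Countable V := by
  have := Λ.countable_arrow
  exact Function.Injective.countable (f := fun v : V => Arrow.mk (𝟙 v))
    fun v w h => congrArg Comma.left h

theorem measurableSet_cylinder (l : Arrow V) : MeasurableSet (cylinder Λ l) :=
  MeasurableSpace.measurableSet_generateFrom ⟨l, rfl⟩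

theorem measurableSet_vertexCylinder (v : V) : MeasurableSet (vertexCylinder Λ v) :=
  measurableSet_cylinder _

theorem measurableSet_seg_mem (p : Fin k → ℕ) (S : Set (Arrow V)) :
    MeasurableSet {x : Λ.InfinitePath | x.seg p ∈ S} := by
  have := Λ.countable_arrow
  have h : {x : Λ.InfinitePath | x.seg p ∈ S} =
      ⋃ c ∈ {c ∈ S | Λ.degree c = p}, cylinder Λ c := by
    ext x
    simp only [Set.mem_iUnion]
    constructor
    · intro hx
      exact ⟨x.seg p, ⟨hx, x.degree_seg p⟩, x.mem_cylinder_seg p⟩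
    · rintro ⟨c, ⟨hc, rfl⟩, hx⟩
      rw [mem_cylinder] at hx
      change x.seg _ ∈ S
      rwa [hx]
  rw [h]
  exact MeasurableSet.biUnion (Set.to_countable _) fun c _ => measurableSet_cylinder c

theorem measurable_of_seg {Y : Type*} [MeasurableSpace Y] {f : Y → Λ.InfinitePath}
    (h : ∀ p c, MeasurableSet {y | (f y).seg p = c}) : Measurable f := by
  refine measurable_generateFrom ?_
  rintro _ ⟨l, rfl⟩
  exact h (Λ.degree l) l

theorem measurable_shift (m : Fin k → ℕ) : Measurable (shift (Λ := Λ) m) := by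
  refine measurable_of_seg fun p c => ?_
  have h : {x : Λ.InfinitePath | (x.shift m).seg p = c} =
      {x | x.seg (m + p) ∈ {e | ∃ l, Λ.degree l = m ∧ IsComp l c e}} := by
    ext x
    constructor
    · rintro rfl
      exact ⟨x.seg m, x.degree_seg m, x.isComp_shift m p⟩
    · rintro ⟨l, hl, hc⟩
      exact ((x.isComp_shift m p).unique hc Λ (by rw [hl, degree_seg])).2
  rw [h]
  exact measurableSet_seg_mem _ _

theorem measurable_prefixMap (l : Arrow V) : Measurable (prefixMap (Λ := Λ) l) := by
  refine measurable_of_seg fun p c => ?_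
  -- On `Z(s(l))` the segment `(l x)(0, p)` is a prefix of `l x(0, p)`, so it depends only on `x(0,
  -- p)`. Elsewhere `prefixMap l` is the identity.
  have h : {x : Λ.InfinitePath | (prefixMap l x).seg p = c} =
      (vertexCylinder Λ l.left ∩
        {x | x.seg p ∈ {a | Λ.degree c = p ∧ ∃ e, IsComp l a e ∧ IsPrefix c e}}) ∪
      ((vertexCylinder Λ l.left)ᶜ ∩ {x | x.seg p ∈ ({c} : Set (Arrow V))}) := by
    ext x
    by_cases hx : x.range = l.left
    · have h0 := mem_vertexCylinder.2 hx
      simp only [Set.mem_union, Set.mem_inter_iff, h0, Set.mem_compl_iff, not_true_eq_false,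
        false_and, or_false, true_and]
      have h1 := isComp_prefixMap hx p
      have h2 := (prefixMap l x).seg_isPrefix (le_add_self : p ≤ Λ.degree l + p)
      constructor
      · rintro rfl
        exact ⟨degree_seg _ _, _, h1, h2⟩
      · rintro ⟨hc, e, he, hce⟩
        rw [← h1.eq he] at hce
        exact h2.eq_of_degree_eq Λ hce (by rw [degree_seg, hc])
    · have h0 : x ∉ vertexCylinder Λ l.left := fun h => hx (mem_vertexCylinder.1 h)
      have h1 : prefixMap l x = x := dif_neg hx
      simp only [Set.mem_union, Set.mem_inter_iff, h0, Set.mem_compl_iff, not_false_eq_true,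
        false_and, false_or, true_and]
      change (prefixMap l x).seg p = c ↔ x.seg p = c
      rw [h1]
  rw [h]
  have hm := measurableSet_vertexCylinder (Λ := Λ) l.left
  exact (hm.inter (measurableSet_seg_mem _ _)).union (hm.compl.inter (measurableSet_seg_mem _ _))

/-- A subset of `Λ^∞` determined by finitely many paths of degree `p`. -/
def IsLevel (p : Fin k → ℕ) (A : Set Λ.InfinitePath) : Prop :=
  ∃ S : Finset (Arrow V), (∀ c ∈ S, Λ.degree c = p) ∧ A = {x | x.seg p ∈ S}

theorem isLevel_cylinder (l : Arrow V) : IsLevel (Λ.degree l) (cylinder Λ l) := by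
  refine ⟨{l}, by simp, ?_⟩
  ext x
  exact Finset.mem_singleton.symm

theorem mem_iff_isPrefix_mem {p q : Fin k → ℕ} (h : p ≤ q) (x : Λ.InfinitePath) (c : Arrow V) :
    x.seg p = c ↔ Λ.degree c = p ∧ x.seg q ∈ Λ.extensions c q := by
  constructor
  · rintro rfl
    exact ⟨x.degree_seg p, x.seg_isPrefix h, x.degree_seg q⟩
  · rintro ⟨hc, h1, -⟩
    exact (x.seg_isPrefix h).eq_of_degree_eq Λ h1 (by rw [degree_seg, hc])

/-- Each path is replaced by its extensions of degree `q`, finite in number by row-finiteness. Any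
two level sets can thus be compared at a common level. -/
theorem IsLevel.mono (hfin : Λ.RowFinite) {p q : Fin k → ℕ} {A : Set Λ.InfinitePath}
    (h : IsLevel p A) (hpq : p ≤ q) : IsLevel q A := by
  classical
  obtain ⟨S, hS, rfl⟩ := h
  refine ⟨S.biUnion fun c => (hfin.finite_extensions c q).toFinset, ?_, ?_⟩
  · simp only [Finset.mem_biUnion, Set.Finite.mem_toFinset]
    rintro c ⟨a, -, -, h⟩
    exact h
  · ext x
    change x.seg p ∈ S ↔ x.seg q ∈ S.biUnion _
    simp only [Finset.mem_biUnion, Set.Finite.mem_toFinset]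
    constructor
    · intro h
      exact ⟨_, h, ((mem_iff_isPrefix_mem hpq x _).1 rfl).2⟩
    · rintro ⟨a, ha, h⟩
      rwa [(mem_iff_isPrefix_mem hpq x a).2 ⟨hS a ha, h⟩]

variable (Λ) in
/-- The ring of sets determined by finitely many finite paths of one degree. -/
def levelSets : Set (Set Λ.InfinitePath) := {A | ∃ p, IsLevel p A}

theorem isLevel_empty (p : Fin k → ℕ) : IsLevel p (∅ : Set Λ.InfinitePath) :=
  ⟨∅, by simp, by simp⟩

theorem IsLevel.union {p : Fin k → ℕ} {A B : Set Λ.InfinitePath} (hA : IsLevel p A)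
    (hB : IsLevel p B) : IsLevel p (A ∪ B) := by
  classical
  obtain ⟨S, hS, rfl⟩ := hA
  obtain ⟨T, hT, rfl⟩ := hB
  refine ⟨S ∪ T, fun c hc => ?_, ?_⟩
  · rcases Finset.mem_union.1 hc with h | h
    exacts [hS c h, hT c h]
  · ext x
    exact Finset.mem_union.symm

theorem IsLevel.sdiff {p : Fin k → ℕ} {A B : Set Λ.InfinitePath} (hA : IsLevel p A)
    (hB : IsLevel p B) : IsLevel p (A \ B) := by
  classical
  obtain ⟨S, hS, rfl⟩ := hA
  obtain ⟨T, hT, rfl⟩ := hB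
  refine ⟨S \ T, fun c hc => hS c (Finset.mem_sdiff.1 hc).1, ?_⟩
  ext x
  exact Finset.mem_sdiff.symm

theorem exists_common_level (hfin : Λ.RowFinite) {A B : Set Λ.InfinitePath}
    (hA : A ∈ levelSets Λ) (hB : B ∈ levelSets Λ) : ∃ p, IsLevel p A ∧ IsLevel p B := by
  obtain ⟨p, hp⟩ := hA
  obtain ⟨q, hq⟩ := hB
  exact ⟨p ⊔ q, hp.mono hfin le_sup_left, hq.mono hfin le_sup_right⟩

theorem isSetRing_levelSets (hfin : Λ.RowFinite) : IsSetRing (levelSets Λ) where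
  empty_mem := ⟨0, isLevel_empty 0⟩
  union_mem A B hA hB := by
    obtain ⟨p, h1, h2⟩ := exists_common_level hfin hA hB
    exact ⟨p, h1.union h2⟩
  sdiff_mem A B hA hB := by
    obtain ⟨p, h1, h2⟩ := exists_common_level hfin hA hB
    exact ⟨p, h1.sdiff h2⟩

theorem isPiSystem_levelSets (hfin : Λ.RowFinite) : IsPiSystem (levelSets Λ) :=
  fun _ hA _ hB _ => (isSetRing_levelSets hfin).inter_mem hA hB

theorem cylinder_mem_levelSets (l : Arrow V) : cylinder Λ l ∈ levelSets Λ :=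
  ⟨_, isLevel_cylinder l⟩

theorem measurableSet_of_mem_levelSets {A : Set Λ.InfinitePath} (hA : A ∈ levelSets Λ) :
    MeasurableSet A := by
  obtain ⟨p, S, -, rfl⟩ := hA
  exact measurableSet_seg_mem p (S : Set (Arrow V))

theorem generateFrom_levelSets :
    (inferInstance : MeasurableSpace Λ.InfinitePath) =
      MeasurableSpace.generateFrom (levelSets Λ) := by
  refine le_antisymm (MeasurableSpace.generateFrom_mono ?_) (MeasurableSpace.generateFrom_le ?_)
  · rintro _ ⟨l, rfl⟩
    exact cylinder_mem_levelSets l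
  · exact fun _ hA => measurableSet_of_mem_levelSets hA

/-! ### Measures and integrals determined by cylinders -/

theorem pairwiseDisjoint_cylinder {p : Fin k → ℕ} {S : Set (Arrow V)}
    (hS : ∀ c ∈ S, Λ.degree c = p) : S.PairwiseDisjoint (cylinder Λ) := by
  intro a ha b hb hab
  refine Set.disjoint_left.2 fun x hxa hxb => hab ?_
  exact eq_of_mem_cylinder hxa hxb (by rw [hS a ha, hS b hb])

theorem setOf_seg_mem {p : Fin k → ℕ} {S : Finset (Arrow V)} (hS : ∀ c ∈ S, Λ.degree c = p) :
    {x : Λ.InfinitePath | x.seg p ∈ S} = ⋃ c ∈ S, cylinder Λ c := by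
  ext x
  simp only [Set.mem_iUnion]
  constructor
  · intro hx
    exact ⟨x.seg p, hx, x.mem_cylinder_seg p⟩
  · rintro ⟨c, hc, hx⟩
    rw [mem_cylinder, hS c hc] at hx
    change x.seg p ∈ S
    rwa [hx]

theorem measure_setOf_seg_mem (μ : Measure Λ.InfinitePath) {p : Fin k → ℕ}
    {S : Finset (Arrow V)} (hS : ∀ c ∈ S, Λ.degree c = p) :
    μ {x | x.seg p ∈ S} = ∑ c ∈ S, μ (cylinder Λ c) := by
  rw [setOf_seg_mem hS]
  exact measure_biUnion_finset (pairwiseDisjoint_cylinder hS) fun c _ => measurableSet_cylinder c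

theorem measure_eq_of_mem_levelSets {μ ν : Measure Λ.InfinitePath}
    (h : ∀ l, μ (cylinder Λ l) = ν (cylinder Λ l)) {A : Set Λ.InfinitePath}
    (hA : A ∈ levelSets Λ) : μ A = ν A := by
  obtain ⟨p, S, hS, rfl⟩ := hA
  rw [measure_setOf_seg_mem μ hS, measure_setOf_seg_mem ν hS]
  exact Finset.sum_congr rfl fun c _ => h c

theorem iUnion_vertexCylinder : ⋃ v, vertexCylinder Λ v = Set.univ :=
  Set.eq_univ_of_forall fun x => Set.mem_iUnion.2 ⟨x.range, mem_vertexCylinder.2 rfl⟩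

/-- Cylinders need not be closed under intersection, so the π-λ argument runs on the level sets,
which are finite disjoint unions of cylinders. The countably many vertex cylinders supply the cover
by sets of finite measure. -/
theorem measure_ext_of_cylinder (hfin : Λ.RowFinite) {μ ν : Measure Λ.InfinitePath}
    (h : ∀ l, μ (cylinder Λ l) = ν (cylinder Λ l)) (hμ : ∀ v, μ (vertexCylinder Λ v) ≠ ∞) :
    μ = ν := by
  have := countable_vertices Λ
  refine Measure.ext_of_generateFrom_of_cover (T := Set.range (vertexCylinder Λ))
    generateFrom_levelSets (Set.countable_range _) (isPiSystem_levelSets hfin)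
    (by rw [Set.sUnion_range, iUnion_vertexCylinder]) ?_ ?_ ?_
  · rintro _ ⟨v, rfl⟩
    exact hμ v
  · rintro _ ⟨v, rfl⟩ A hA
    exact measure_eq_of_mem_levelSets h
      ((isSetRing_levelSets hfin).inter_mem hA (cylinder_mem_levelSets _))
  · rintro _ ⟨v, rfl⟩
    exact h _

theorem sigmaFinite_of_vertexCylinder {μ : Measure Λ.InfinitePath}
    (hμ : ∀ v, μ (vertexCylinder Λ v) < ∞) : SigmaFinite μ := by
  have := countable_vertices Λ
  exact Measure.sigmaFinite_of_countable (S := Set.range (vertexCylinder Λ))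
    (Set.countable_range _) (by rintro _ ⟨v, rfl⟩; exact hμ v)
    (by rw [Set.sUnion_range, iUnion_vertexCylinder])

/-- A locally integrable function whose integrals over all cylinders vanish is null. -/
theorem ae_eq_zero_of_setIntegral_cylinder (hfin : Λ.RowFinite) {μ : Measure Λ.InfinitePath}
    {f : Λ.InfinitePath → ℂ}
    (hf : ∀ v, IntegrableOn f (vertexCylinder Λ v) μ)
    (h : ∀ l, ∫ x in cylinder Λ l, f x ∂μ = 0) : f =ᵐ[μ] 0 := by
  have hc := countable_vertices Λ
  have key : ∀ v, f =ᵐ[μ.restrict (vertexCylinder Λ v)] 0 := by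
    intro v
    -- Restricting to one vertex cylinder makes `f` integrable, and the integral over the whole
    -- restricted space, needed for complements, is one of those assumed to vanish.
    have hE : ∀ E, MeasurableSet E → ∫ x in E, f x ∂μ.restrict (vertexCylinder Λ v) = 0 := by
      intro E hE
      induction E, hE using MeasurableSpace.induction_on_inter generateFrom_levelSets
        (isPiSystem_levelSets hfin) with
      | empty => simp
      | basic A hA =>
        have hm : MeasurableSet A := measurableSet_of_mem_levelSets hA
        rw [Measure.restrict_restrict hm]
        have h1 : A ∩ vertexCylinder Λ v ⊆ vertexCylinder Λ v := Set.inter_subset_right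
        obtain ⟨p, S, hS, h2⟩ :=
          (isSetRing_levelSets hfin).inter_mem hA (cylinder_mem_levelSets (Arrow.mk (𝟙 v)))
        change A ∩ vertexCylinder Λ v = _ at h2
        rw [h2] at h1 ⊢
        rw [setOf_seg_mem hS] at h1 ⊢
        rw [integral_biUnion_finset _ (fun c _ => measurableSet_cylinder c)
          (pairwiseDisjoint_cylinder hS)
          fun c hc => (hf v).mono_set ((Set.subset_biUnion_of_mem hc).trans h1)]
        exact Finset.sum_eq_zero fun c _ => h c
      | compl E hE ih =>
        have h1 := integral_add_compl hE (hf v)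
        rw [ih, zero_add] at h1
        rw [h1]
        exact h _
      | iUnion E hd hm ih =>
        rw [integral_iUnion hm hd (hf v).integrableOn]
        simp [ih]
    exact Integrable.ae_eq_zero_of_forall_setIntegral_eq_zero (hf v) fun E hE1 _ => hE E hE1
  have h2 := ae_restrict_iUnion_iff (μ := μ) (vertexCylinder Λ) (fun x => f x = 0)
  rw [iUnion_vertexCylinder, Measure.restrict_univ] at h2
  exact h2.2 key

/-! ### Measures with prescribed values on cylinders -/

/-- Carathéodory extension from the ring of level sets. At level `p` the content is the restriction
of an atomic measure, so additivity is free, and `hw` makes the choice of level immaterial.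
Countable additivity reduces to continuity at `∅`, which is compactness. -/
theorem exists_measure_cylinder (hfin : Λ.RowFinite) (hsrc : Λ.SourceFree)
    (w : Arrow V → ℝ≥0∞) (hw_top : ∀ l, w l ≠ ∞)
    (hw : ∀ l q, Λ.degree l ≤ q → w l = ∑ c ∈ (hfin.finite_extensions l q).toFinset, w c) :
    ∃ μ : Measure Λ.InfinitePath, ∀ l, μ (cylinder Λ l) = w l := by
  classical
  choose pt hpt using nonempty_cylinder hfin hsrc
  -- `M p` puts mass `w c` at a chosen point of `Z(c)`, for each path `c` of degree `p`.
  let M (p : Fin k → ℕ) : Measure Λ.InfinitePath :=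
    Measure.sum fun c : Arrow V => (if Λ.degree c = p then w c else 0) • Measure.dirac (pt c)
  have hM : ∀ l q, Λ.degree l ≤ q → M q (cylinder Λ l) = w l := by
    intro l q hlq
    rw [Measure.sum_apply _ (measurableSet_cylinder l), hw l q hlq,
      tsum_eq_sum (s := (hfin.finite_extensions l q).toFinset)]
    · refine Finset.sum_congr rfl fun c hc => ?_
      obtain ⟨h1, h2⟩ := (Set.Finite.mem_toFinset _).1 hc
      have h3 : pt c ∈ cylinder Λ l := cylinder_subset_of_isPrefix h1 (hpt c)
      simp [h2, Measure.dirac_apply' _ (measurableSet_cylinder l), h3]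
    · intro c hc
      rw [Set.Finite.mem_toFinset] at hc
      by_cases h1 : Λ.degree c = q
      · have h3 : pt c ∉ cylinder Λ l := by
          intro h4
          rw [mem_cylinder_iff_isPrefix hlq, ← h1, mem_cylinder.1 (hpt c)] at h4
          exact hc ⟨h4, h1⟩
        simp only [if_pos h1, Measure.smul_apply, Measure.dirac_apply' _ (measurableSet_cylinder l),
          Set.indicator_of_notMem h3, smul_zero]
      · simp only [if_neg h1, zero_smul, Measure.coe_zero, Pi.zero_apply]
  have hM' : ∀ A p q, IsLevel p A → p ≤ q → M p A = M q A := by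
    rintro _ p q ⟨S, hS, rfl⟩ hpq
    rw [measure_setOf_seg_mem _ hS, measure_setOf_seg_mem _ hS]
    refine Finset.sum_congr rfl fun c hc => ?_
    rw [hM c p (hS c hc).le, hM c q ((hS c hc).le.trans hpq)]
  let m (A : Set Λ.InfinitePath) : ℝ≥0∞ := if h : A ∈ levelSets Λ then M h.choose A else 0
  have hm : ∀ A p, IsLevel p A → m A = M p A := by
    intro A p h
    have h1 : A ∈ levelSets Λ := ⟨p, h⟩
    simp only [m, dif_pos h1]
    rw [hM' A _ (h1.choose ⊔ p) h1.choose_spec le_sup_left, hM' A p _ h le_sup_right]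
  let C := (isSetRing_levelSets hfin).addContent_of_union m
    (by rw [hm ∅ 0 (isLevel_empty 0), measure_empty]) (by
      intro A B hA hB hAB
      obtain ⟨p, h1, h2⟩ := exists_common_level hfin hA hB
      rw [hm _ p h1, hm _ p h2, hm _ p (h1.union h2)]
      exact measure_union hAB (measurableSet_of_mem_levelSets ⟨p, h2⟩))
  have hCm : ∀ A, C A = m A := fun A => rfl
  have hC_sub : C.IsSigmaSubadditive := by
    refine isSigmaSubadditive_of_addContent_iUnion_eq_tsum (isSetRing_levelSets hfin)
      fun f hf hf_Union hf' => ?_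
    refine addContent_iUnion_eq_sum_of_tendsto_zero (isSetRing_levelSets hfin) C ?_ ?_
      hf hf_Union hf'
    · rintro _ ⟨p, S, hS, rfl⟩
      rw [hCm, hm _ p ⟨S, hS, rfl⟩, measure_setOf_seg_mem _ hS]
      refine (ENNReal.sum_lt_top.2 fun c hc => ?_).ne
      rw [hM c p (hS c hc).le]
      exact (hw_top c).lt_top
    · intro A hA hanti hemp
      -- By compactness a decreasing sequence of level sets with empty intersection is eventually
      -- empty, so its content is eventually zero.
      have h1 : ∃ i, A i = ∅ := by
        by_contra! hne
        have := nonempty_iInter_of_antitone hfin A (fun i => by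
          obtain ⟨p, S, -, h⟩ := hA i
          exact ⟨p, S, S.finite_toSet, h⟩) hanti hne
        rw [hemp] at this
        exact Set.not_nonempty_empty this
      obtain ⟨i, hi⟩ := h1
      refine tendsto_const_nhds.congr' ?_
      filter_upwards [Filter.eventually_ge_atTop i] with j hj
      have : A j = ∅ := Set.subset_empty_iff.1 (hi ▸ hanti hj)
      rw [this, addContent_empty]
  refine ⟨C.measure (isSetRing_levelSets hfin).isSetSemiring
    (generateFrom_levelSets (Λ := Λ)).le hC_sub, fun l => ?_⟩
  rw [C.measure_eq _ generateFrom_levelSets _ (cylinder_mem_levelSets l), hCm,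
    hm _ _ (isLevel_cylinder l), hM l _ le_rfl]

end InfinitePath

variable {k : ℕ} {V : Type u} [SmallCategory V] {Λ : KGraph k V}

/-! ### Minimal common extensions -/

/-- The minimal common extensions of two paths. -/
noncomputable def commonExtensions (hfin : Λ.RowFinite) (l m : Arrow V) : Finset (Arrow V) :=
  (((hfin.finite_extensions l (Λ.degree l ⊔ Λ.degree m)).inter_of_left
    {c | IsPrefix m c})).toFinset

theorem mem_commonExtensions {hfin : Λ.RowFinite} {l m c : Arrow V} :
    c ∈ commonExtensions hfin l m ↔
      IsPrefix l c ∧ IsPrefix m c ∧ Λ.degree c = Λ.degree l ⊔ Λ.degree m := by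
  rw [commonExtensions, Set.Finite.mem_toFinset]
  exact ⟨fun h => ⟨h.1.1, h.2, h.1.2⟩, fun h => ⟨⟨h.1, h.2.2⟩, h.2.1⟩⟩

theorem degree_of_mem_commonExtensions {hfin : Λ.RowFinite} {l m : Arrow V} :
    ∀ c ∈ commonExtensions hfin l m, Λ.degree c = Λ.degree l ⊔ Λ.degree m :=
  fun _ hc => (mem_commonExtensions.1 hc).2.2

theorem InfinitePath.cylinder_inter_cylinder (hfin : Λ.RowFinite) (l m : Arrow V) :
    cylinder Λ l ∩ cylinder Λ m = ⋃ c ∈ commonExtensions hfin l m, cylinder Λ c := by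
  rw [← setOf_seg_mem degree_of_mem_commonExtensions]
  ext x
  change _ ↔ x.seg _ ∈ commonExtensions hfin l m
  rw [mem_commonExtensions, Set.mem_inter_iff,
    mem_cylinder_iff_isPrefix (q := Λ.degree l ⊔ Λ.degree m) le_sup_left,
    mem_cylinder_iff_isPrefix (q := Λ.degree l ⊔ Λ.degree m) le_sup_right]
  exact ⟨fun h => ⟨h.1, h.2, x.degree_seg _⟩, fun h => ⟨h.1, h.2.1⟩⟩

/-! ### Cuntz-Krieger families of operators -/

theorem IsCuntzKrieger.map {A B : Type*} [NonUnitalRing A] [StarRing A] [Module ℂ A]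
    [NonUnitalRing B] [StarRing B] [Module ℂ B] {t : Arrow V → A} (h : Λ.IsCuntzKrieger t)
    (hfin : Λ.RowFinite) (φ : A →⋆ₙₐ[ℂ] B) : Λ.IsCuntzKrieger fun l => φ (t l) where
  partialIsometry l := by rw [← map_star, ← map_mul, ← map_mul, h.partialIsometry]
  vertex_proj v := (h.vertex_proj v).map φ
  vertex_orth v w hvw := by rw [← map_mul, h.vertex_orth v w hvw, map_zero]
  mul g f := by rw [← map_mul, h.mul]
  star_mul l := by rw [← map_star, ← map_mul, h.star_mul]
  vertex_eq_sum v n := by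
    rw [h.vertex_eq_sum v n, finsum_mem_eq_finite_toFinset_sum _ (hfin v n),
      finsum_mem_eq_finite_toFinset_sum _ (hfin v n), map_sum]
    simp only [map_mul, map_star]

namespace IsCuntzKrieger

section Algebra

variable {A : Type*} [NonUnitalRing A] [StarRing A] {t : Arrow V → A}
  (h : Λ.IsCuntzKrieger t)

include h

theorem mul_of_isComp {l a c : Arrow V} (hc : IsComp l a c) : t l * t a = t c := by
  obtain ⟨_, _, _, g, f, rfl, rfl, rfl⟩ := hc
  exact h.mul g f

theorem mul_source (l : Arrow V) : t l * t (Arrow.mk (𝟙 l.left)) = t l :=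
  h.mul_of_isComp (isComp_id_right l)

theorem range_mul (l : Arrow V) : t (Arrow.mk (𝟙 l.right)) * t l = t l :=
  h.mul_of_isComp (isComp_id_left l)

theorem star_mul_range (l : Arrow V) : star (t l) * t (Arrow.mk (𝟙 l.right)) = star (t l) := by
  have h1 := congrArg star (h.range_mul l)
  rwa [StarMul.star_mul, (h.vertex_proj _).isSelfAdjoint.star_eq] at h1

theorem isStarProjection_mul_star (l : Arrow V) : IsStarProjection (t l * star (t l)) where
  isIdempotentElem := by
    change t l * star (t l) * (t l * star (t l)) = _
    rw [← mul_assoc, h.partialIsometry]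
  isSelfAdjoint := IsSelfAdjoint.mul_star_self _

theorem mul_proj_mul_star {l a c : Arrow V} (hc : IsComp l a c) :
    t l * (t a * star (t a)) * star (t l) = t c * star (t c) := by
  rw [← h.mul_of_isComp hc, StarMul.star_mul, ← mul_assoc, mul_assoc _ (star (t a))]

/-- The algebraic form of the fact that, inside `Z(l)`, `σ^{d(l)}(x) ∈ Z(a)` means `x ∈ Z(l a)`. It
is what makes `t_l` act as a weighted composition operator. -/
theorem mul_proj {l a c : Arrow V} (hc : IsComp l a c) :
    t l * (t a * star (t a)) = t c * star (t c) * t l := by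
  rw [← h.mul_proj_mul_star hc, mul_assoc _ (star (t l)), h.star_mul, ← hc.right_eq_left,
    mul_assoc, mul_assoc, h.star_mul_range]

/-- Insert the source projection between `t l` and its adjoint and expand it in degree `q - d(l)`;
the map `a ↦ l a` reindexes the sum by extensions of `l`. -/
theorem proj_eq_sum (hfin : Λ.RowFinite) {l : Arrow V} {q : Fin k → ℕ} (hq : Λ.degree l ≤ q) :
    t l * star (t l) = ∑ c ∈ (hfin.finite_extensions l q).toFinset, t c * star (t c) := by
  have h1 : t l * star (t l) = t l * t (Arrow.mk (𝟙 l.left)) * star (t l) := by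
    rw [h.mul_source]
  rw [h1, h.vertex_eq_sum l.left (q - Λ.degree l), finsum_mem_eq_finite_toFinset_sum _ (hfin _ _),
    Finset.mul_sum, Finset.sum_mul]
  have h2 : ∀ a : Arrow V, ∃ c, a.right = l.left → IsComp l a c := fun a => by
    by_cases ha : a.right = l.left
    · obtain ⟨c, hc⟩ := exists_isComp ha
      exact ⟨c, fun _ => hc⟩
    · exact ⟨l, fun h => absurd h ha⟩
  choose f hf using h2
  refine Finset.sum_nbij f ?_ ?_ ?_ ?_
  · intro a ha
    rw [Set.Finite.mem_toFinset] at ha ⊢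
    exact ⟨(hf a ha.1).isPrefix, by
      rw [(hf a ha.1).degree_eq Λ, ha.2, add_tsub_cancel_of_le hq]⟩
  · intro a ha b hb hab
    rw [Finset.mem_coe, Set.Finite.mem_toFinset] at ha hb
    have h3 := hf a ha.1
    rw [hab] at h3
    exact (h3.unique (hf b hb.1) Λ rfl).2
  · intro c hc
    rw [Finset.mem_coe, Set.Finite.mem_toFinset] at hc
    obtain ⟨⟨a, ha⟩, hc⟩ := hc
    refine ⟨a, ?_, (hf a ha.right_eq_left).eq ha⟩
    rw [Finset.mem_coe, Set.Finite.mem_toFinset]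
    refine ⟨ha.right_eq_left, ?_⟩
    rw [← hc, ha.degree_eq Λ, add_tsub_cancel_left]
  · intro a ha
    rw [Set.Finite.mem_toFinset] at ha
    exact h.mul_proj_mul_star (hf a ha.1)

end Algebra

section Hilbert

variable {H : Type*} [NormedAddCommGroup H] [InnerProductSpace ℂ H] [CompleteSpace H]
  {t : Arrow V → H →L[ℂ] H} (h : Λ.IsCuntzKrieger t)

include h

theorem inner_proj_left (l : Arrow V) (x y : H) :
    inner ℂ ((t l * star (t l)) x) y = inner ℂ x ((t l * star (t l)) y) := by
  have h1 := (h.isStarProjection_mul_star l).isSelfAdjoint.star_eq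
  conv_lhs => rw [← h1, ContinuousLinearMap.star_eq_adjoint]
  exact ContinuousLinearMap.adjoint_inner_left _ _ _

theorem inner_proj_self (l : Arrow V) (x : H) :
    inner ℂ x ((t l * star (t l)) x) = ((‖(t l * star (t l)) x‖ ^ 2 : ℝ) : ℂ) := by
  have h1 : (t l * star (t l)) x = (t l * star (t l)) ((t l * star (t l)) x) := by
    conv_lhs => rw [← (h.isStarProjection_mul_star l).isIdempotentElem.eq]
    rfl
  rw [h1, ← h.inner_proj_left, inner_self_eq_norm_sq_to_K, ← h1]
  norm_num

/-- The relations give the sum of the range projections, and orthogonality comes from positivity. If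
`y` lies in the range of the projection of `m`, then `‖y‖²` is the sum of all `‖(t c * star (t c))
y‖²`, and the term for `m` alone is already `‖y‖²`. Paths with different ranges are separated by
their vertex projections. -/
theorem proj_mul_proj_of_ne (hfin : Λ.RowFinite) {l m : Arrow V}
    (hd : Λ.degree l = Λ.degree m) (hlm : l ≠ m) :
    t l * star (t l) * (t m * star (t m)) = 0 := by
  by_cases hr : l.right = m.right
  · ext x
    set y := (t m * star (t m)) x with hy
    change (t l * star (t l)) y = 0
    have h1 : (t m * star (t m)) y = y := by
      rw [hy]
      conv_rhs => rw [← (h.isStarProjection_mul_star m).isIdempotentElem.eq]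
      rfl
    have h2 : t (Arrow.mk (𝟙 m.right)) y = y := by
      have h0 : t (Arrow.mk (𝟙 m.right)) * (t m * star (t m)) = t m * star (t m) := by
        rw [← mul_assoc, h.range_mul]
      exact DFunLike.congr_fun h0 x
    have h3 : inner ℂ y y = ∑ c ∈ (hfin m.right (Λ.degree m)).toFinset,
        inner ℂ y ((t c * star (t c)) y) := by
      have h0 : inner ℂ y y = inner ℂ y (t (Arrow.mk (𝟙 m.right)) y) := by rw [h2]
      rw [h0, h.vertex_eq_sum m.right (Λ.degree m),
        finsum_mem_eq_finite_toFinset_sum _ (hfin _ _), _root_.sum_apply, inner_sum]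
    simp only [h.inner_proj_self] at h3
    have h4 : ‖y‖ ^ 2 = ∑ c ∈ (hfin m.right (Λ.degree m)).toFinset,
        ‖(t c * star (t c)) y‖ ^ 2 := by
      have h0 : ((‖y‖ ^ 2 : ℝ) : ℂ) = inner ℂ y y := by
        rw [inner_self_eq_norm_sq_to_K]
        norm_num
      rw [h3] at h0
      exact_mod_cast h0
    classical
    have h5 : ({l, m} : Finset (Arrow V)) ⊆ (hfin m.right (Λ.degree m)).toFinset := by
      intro c hc
      rw [Set.Finite.mem_toFinset]
      rcases Finset.mem_insert.1 hc with rfl | hc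
      · exact ⟨hr, hd⟩
      · rw [Finset.mem_singleton.1 hc]
        exact ⟨rfl, rfl⟩
    have h6 := Finset.sum_le_sum_of_subset_of_nonneg (f := fun c => ‖(t c * star (t c)) y‖ ^ 2)
      h5 fun c _ _ => sq_nonneg _
    rw [Finset.sum_pair hlm, h1, ← h4] at h6
    have h7 : ‖(t l * star (t l)) y‖ ^ 2 = 0 := le_antisymm (by linarith) (sq_nonneg _)
    exact norm_eq_zero.1 (pow_eq_zero_iff two_ne_zero |>.1 h7)
  · rw [← h.star_mul_range l, ← h.range_mul m]
    have := h.vertex_orth _ _ hr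
    calc _ = t l * star (t l) * (t (Arrow.mk (𝟙 l.right)) * t (Arrow.mk (𝟙 m.right))) * t m *
          star (t (Arrow.mk (𝟙 m.right)) * t m) := by simp only [mul_assoc]
      _ = 0 := by rw [this, mul_zero, zero_mul, zero_mul]

/-- Expand both factors in degree `d(l) ∨ d(m)`; by orthogonality only the paths extending both
survive. -/
theorem proj_mul_proj (hfin : Λ.RowFinite) (l m : Arrow V) :
    t l * star (t l) * (t m * star (t m)) =
      ∑ c ∈ commonExtensions hfin l m, t c * star (t c) := by
  classical
  conv_lhs => rw [h.proj_eq_sum hfin (le_sup_left : Λ.degree l ≤ Λ.degree l ⊔ Λ.degree m),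
    h.proj_eq_sum hfin (le_sup_right : Λ.degree m ≤ Λ.degree l ⊔ Λ.degree m), Finset.sum_mul]
  have h0 : commonExtensions hfin l m =
      (hfin.finite_extensions l (Λ.degree l ⊔ Λ.degree m)).toFinset.filter
        (fun c => IsPrefix m c) := by
    ext c
    rw [mem_commonExtensions, Finset.mem_filter, Set.Finite.mem_toFinset]
    exact ⟨fun h => ⟨⟨h.1, h.2.2⟩, h.2.1⟩, fun h => ⟨h.1.1, h.2, h.1.2⟩⟩
  rw [h0, Finset.sum_filter]
  refine Finset.sum_congr rfl fun c hc => ?_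
  rw [Set.Finite.mem_toFinset] at hc
  rw [Finset.mul_sum]
  split_ifs with hm
  · rw [Finset.sum_eq_single c]
    · exact (h.isStarProjection_mul_star c).isIdempotentElem.eq
    · intro b hb hbc
      rw [Set.Finite.mem_toFinset] at hb
      exact h.proj_mul_proj_of_ne hfin (hc.2.trans hb.2.symm) hbc.symm
    · intro h1
      rw [Set.Finite.mem_toFinset] at h1
      exact absurd ⟨hm, hc.2⟩ h1
  · refine Finset.sum_eq_zero fun b hb => ?_
    rw [Set.Finite.mem_toFinset] at hb
    refine h.proj_mul_proj_of_ne hfin (hc.2.trans hb.2.symm) ?_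
    rintro rfl
    exact hm hb.1

/-- The Gram matrix of the vectors `p_l x` depends only on the numbers `‖p_c x‖²`. Its counterpart
for indicator functions is `inner_cylinderOne`. -/
theorem inner_proj_proj (hfin : Λ.RowFinite) (l m : Arrow V) (x : H) :
    inner ℂ ((t l * star (t l)) x) ((t m * star (t m)) x) =
      ∑ c ∈ commonExtensions hfin l m, ((‖(t c * star (t c)) x‖ ^ 2 : ℝ) : ℂ) := by
  rw [h.inner_proj_left]
  change inner ℂ x ((t l * star (t l) * (t m * star (t m))) x) = _
  rw [h.proj_mul_proj hfin, _root_.sum_apply, inner_sum]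
  exact Finset.sum_congr rfl fun c _ => h.inner_proj_self c x

theorem norm_sq_proj_eq_sum (hfin : Λ.RowFinite) {l : Arrow V} {q : Fin k → ℕ}
    (hq : Λ.degree l ≤ q) (x : H) : ‖(t l * star (t l)) x‖ ^ 2 =
      ∑ c ∈ (hfin.finite_extensions l q).toFinset, ‖(t c * star (t c)) x‖ ^ 2 := by
  have h1 := h.inner_proj_self l x
  rw [h.proj_eq_sum hfin hq, _root_.sum_apply, inner_sum] at h1
  simp only [h.inner_proj_self] at h1
  rw [h.proj_eq_sum hfin hq, _root_.sum_apply]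
  exact_mod_cast h1.symm

/-- The measure on `Λ^∞` determined by a vector. -/
theorem exists_measure (hfin : Λ.RowFinite) (hsrc : Λ.SourceFree) (x : H) :
    ∃ μ : Measure Λ.InfinitePath, ∀ l, μ (InfinitePath.cylinder Λ l) =
      ENNReal.ofReal (‖(t l * star (t l)) x‖ ^ 2) := by
  refine InfinitePath.exists_measure_cylinder hfin hsrc _ (fun _ => ENNReal.ofReal_ne_top) ?_
  intro l q hq
  rw [h.norm_sq_proj_eq_sum hfin hq, ENNReal.ofReal_sum_of_nonneg fun _ _ => sq_nonneg _]

end Hilbert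

end IsCuntzKrieger

/-! ### The measure of a vector -/

section Representations

variable {H : Type*} [NormedAddCommGroup H] [InnerProductSpace ℂ H] [CompleteSpace H]
  {π : Λ.CStar →⋆ₙₐ[ℂ] (H →L[ℂ] H)}

theorem isCuntzKrieger_map_gen (hfin : Λ.RowFinite) (π : Λ.CStar →⋆ₙₐ[ℂ] (H →L[ℂ] H)) :
    Λ.IsCuntzKrieger fun l => π (Λ.gen l) := (Λ.isCuntzKrieger_gen hfin).map hfin π

theorem isMonicMeasure_iff (hfin : Λ.RowFinite) {ξ : H} {μ : Measure Λ.InfinitePath} :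
    IsMonicMeasure π ξ μ ↔ ∀ l, μ (InfinitePath.cylinder Λ l) =
      ENNReal.ofReal (‖(π (Λ.gen l) * star (π (Λ.gen l))) ξ‖ ^ 2) := by
  refine forall_congr' fun l => ?_
  rw [(isCuntzKrieger_map_gen hfin π).inner_proj_self, Complex.ofReal_re]

theorem exists_isMonicMeasure (hfin : Λ.RowFinite) (hsrc : Λ.SourceFree) (ξ : H) :
    ∃ μ : Measure Λ.InfinitePath, IsMonicMeasure π ξ μ := by
  obtain ⟨μ, hμ⟩ := (isCuntzKrieger_map_gen hfin π).exists_measure hfin hsrc ξ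
  exact ⟨μ, (isMonicMeasure_iff hfin).2 hμ⟩

theorem IsMonicMeasure.cylinder_lt_top {ξ : H} {μ : Measure Λ.InfinitePath}
    (hμ : IsMonicMeasure π ξ μ) (l : Arrow V) : μ (InfinitePath.cylinder Λ l) < ∞ := by
  rw [hμ l]
  exact ENNReal.ofReal_lt_top

theorem IsMonicMeasure.unique (hfin : Λ.RowFinite) {ξ : H} {μ ν : Measure Λ.InfinitePath}
    (hμ : IsMonicMeasure π ξ μ) (hν : IsMonicMeasure π ξ ν) : μ = ν :=
  InfinitePath.measure_ext_of_cylinder hfin (fun l => by rw [hμ l, hν l])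
    fun _ => (hμ.cylinder_lt_top _).ne

end Representations

end KGraph

/-! ### Unitaries from equal Gram matrices -/

theorem denseRange_linearCombination {ι E : Type*} [NormedAddCommGroup E] [InnerProductSpace ℂ E]
    {w : ι → E} (hw : (Submodule.span ℂ (Set.range w)).topologicalClosure = ⊤) :
    DenseRange (Finsupp.linearCombination ℂ w) := by
  rw [DenseRange, ← LinearMap.coe_range, Finsupp.range_linearCombination]
  exact (Submodule.dense_iff_topologicalClosure_eq_top).2 hw

/-- Equal Gram matrices give corresponding linear combinations equal norms, so the identity of `ι →₀
ℂ` extends to the completions. -/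
theorem exists_linearIsometryEquiv_of_inner_eq {ι H K : Type*} [NormedAddCommGroup H]
    [InnerProductSpace ℂ H] [CompleteSpace H] [NormedAddCommGroup K] [InnerProductSpace ℂ K]
    [CompleteSpace K] (u : ι → H) (v : ι → K)
    (hu : (Submodule.span ℂ (Set.range u)).topologicalClosure = ⊤)
    (hv : (Submodule.span ℂ (Set.range v)).topologicalClosure = ⊤)
    (h : ∀ i j, inner ℂ (u i) (u j) = inner ℂ (v i) (v j)) :
    ∃ U : H ≃ₗᵢ[ℂ] K, ∀ i, U (u i) = v i := by
  have hn : ∀ c, ‖Finsupp.linearCombination ℂ v (LinearEquiv.refl ℂ (ι →₀ ℂ) c)‖ =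
      ‖Finsupp.linearCombination ℂ u c‖ := by
    intro c
    rw [LinearEquiv.refl_apply, @norm_eq_sqrt_re_inner ℂ, @norm_eq_sqrt_re_inner ℂ]
    congr 2
    simp only [Finsupp.linearCombination_apply, Finsupp.sum, sum_inner, inner_sum,
      inner_smul_left, inner_smul_right, h]
  refine ⟨(LinearEquiv.refl ℂ (ι →₀ ℂ)).extendOfIsometry (Finsupp.linearCombination ℂ u)
    (Finsupp.linearCombination ℂ v) (denseRange_linearCombination hu)
    (denseRange_linearCombination hv) hn, fun i => ?_⟩
  have h1 := (LinearEquiv.refl ℂ (ι →₀ ℂ)).extendOfIsometry_eq (Finsupp.linearCombination ℂ u)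
    (Finsupp.linearCombination ℂ v) (denseRange_linearCombination hu)
    (denseRange_linearCombination hv) hn (Finsupp.single i 1)
  simpa using h1

/-! ### Weighted composition operators on `L²` -/

section WeightedComposition

variable {X : Type*} [MeasurableSpace X] {μ : Measure X}

theorem eLpNorm_two_sq (f : X → ℂ) : eLpNorm f 2 μ ^ 2 = ∫⁻ x, ‖f x‖ₑ ^ 2 ∂μ := by
  have := eLpNorm_nnreal_pow_eq_lintegral (μ := μ) (f := f) (p := 2) two_ne_zero
  simpa using this

/-- The norm of `F · (h ∘ σ)` is that of `h` for the pushforward of `|F|² μ`; the weighted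
composition operator is therefore a contraction once this pushforward is at most `μ`. -/
theorem lintegral_enorm_mul_comp_sq {F : X → ℂ} (hF : Measurable F) {σ : X → X}
    (hσ : Measurable σ) {h : X → ℂ} (hh : Measurable h) :
    ∫⁻ x, ‖F x * h (σ x)‖ₑ ^ 2 ∂μ =
      ∫⁻ y, ‖h y‖ₑ ^ 2 ∂(μ.withDensity fun x => ‖F x‖ₑ ^ 2).map σ := by
  rw [lintegral_map (by fun_prop) hσ, lintegral_withDensity_eq_lintegral_mul _ (by fun_prop)
    (by fun_prop)]
  simp only [Pi.mul_apply, enorm_mul, mul_pow]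

/-- Composition with `σ` alone need not respect almost everywhere equality. Null sets pull back to
null sets where `F ≠ 0`, and elsewhere the factor `F` hides the ambiguity. -/
theorem ae_eq_zero_or_of_map_le {F : X → ℂ} (hF : Measurable F) {σ : X → X} (hσ : Measurable σ)
    (hle : (μ.withDensity fun x => ‖F x‖ₑ ^ 2).map σ ≤ μ) {p : X → Prop} (hp : ∀ᵐ x ∂μ, p x) :
    ∀ᵐ x ∂μ, F x = 0 ∨ p (σ x) := by
  have h1 : ∀ᵐ x ∂μ.withDensity fun x => ‖F x‖ₑ ^ 2, p (σ x) :=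
    ae_of_ae_map hσ.aemeasurable (Measure.absolutelyContinuous_of_le hle hp)
  rw [ae_withDensity_iff (by fun_prop)] at h1
  filter_upwards [h1] with x hx
  by_cases h0 : F x = 0
  · exact Or.inl h0
  · exact Or.inr (hx (by simpa using h0))

/-- The operator `h ↦ F · (h ∘ σ)` on `L²(μ)`. -/
theorem exists_weightedComp {F : X → ℂ} (hF : Measurable F) {σ : X → X} (hσ : Measurable σ)
    (hle : (μ.withDensity fun x => ‖F x‖ₑ ^ 2).map σ ≤ μ) :
    ∃ S : Lp ℂ 2 μ →L[ℂ] Lp ℂ 2 μ, ∀ h : Lp ℂ 2 μ, S h =ᵐ[μ] fun x => F x * h (σ x) := by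
  have hmeas : ∀ h : Lp ℂ 2 μ, Measurable h := fun h => (Lp.stronglyMeasurable h).measurable
  have hnorm : ∀ h : Lp ℂ 2 μ, eLpNorm (fun x => F x * h (σ x)) 2 μ ≤ eLpNorm h 2 μ := by
    intro h
    rw [← ENNReal.pow_le_pow_left_iff two_ne_zero, eLpNorm_two_sq, eLpNorm_two_sq,
      lintegral_enorm_mul_comp_sq hF hσ (hmeas h)]
    exact lintegral_mono' hle le_rfl
  have hmem : ∀ h : Lp ℂ 2 μ, MemLp (fun x => F x * h (σ x)) 2 μ := fun h =>
    ⟨(hF.mul ((hmeas h).comp hσ)).aestronglyMeasurable,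
      (hnorm h).trans_lt (Lp.eLpNorm_lt_top h)⟩
  have hae := fun p => ae_eq_zero_or_of_map_le (p := p) hF hσ hle
  refine ⟨LinearMap.mkContinuous
    { toFun := fun h => (hmem h).toLp _
      map_add' := fun f g => ?_
      map_smul' := fun c f => ?_ } 1 fun h => ?_, fun h => (hmem h).coeFn_toLp⟩
  · ext1
    filter_upwards [(hmem (f + g)).coeFn_toLp, (hmem f).coeFn_toLp, (hmem g).coeFn_toLp,
      Lp.coeFn_add ((hmem f).toLp _) ((hmem g).toLp _), hae _ (Lp.coeFn_add f g)]
      with x h1 h2 h3 h4 h5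
    rw [h1, h4, Pi.add_apply, h2, h3]
    rcases h5 with h5 | h5
    · simp [h5]
    · rw [h5, Pi.add_apply, mul_add]
  · ext1
    filter_upwards [(hmem (c • f)).coeFn_toLp, (hmem f).coeFn_toLp,
      Lp.coeFn_smul c ((hmem f).toLp _), hae _ (Lp.coeFn_smul c f)] with x h1 h2 h3 h4
    rw [h1, RingHom.id_apply, h3, Pi.smul_apply, h2]
    rcases h4 with h4 | h4
    · simp [h4]
    · rw [h4, Pi.smul_apply, smul_eq_mul, smul_eq_mul, mul_left_comm]
  · rw [one_mul]
    change ‖(hmem h).toLp _‖ ≤ ‖h‖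
    rw [Lp.norm_toLp, Lp.norm_def]
    exact ENNReal.toReal_mono (Lp.eLpNorm_lt_top h).ne (hnorm h)

theorem exists_indicatorMul (μ : Measure X) {E : Set X} (hE : MeasurableSet E) :
    ∃ S : Lp ℂ 2 μ →L[ℂ] Lp ℂ 2 μ, ∀ h : Lp ℂ 2 μ, S h =ᵐ[μ] E.indicator h := by
  obtain ⟨S, hS⟩ := exists_weightedComp (μ := μ) (F := E.indicator 1)
    (measurable_one.indicator hE) measurable_id (by
      rw [Measure.map_id]
      refine Measure.le_iff.2 fun s hs => ?_
      rw [withDensity_apply _ hs, ← setLIntegral_one]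
      refine lintegral_mono fun x => ?_
      by_cases hx : x ∈ E <;> simp [hx])
  refine ⟨S, fun h => (hS h).trans (Filter.Eventually.of_forall fun x => ?_)⟩
  by_cases hx : x ∈ E <;> simp [hx]

/-- Multiplication by the indicator function of a measurable set. -/
noncomputable def indicatorMul (μ : Measure X) {E : Set X} (hE : MeasurableSet E) :
    Lp ℂ 2 μ →L[ℂ] Lp ℂ 2 μ := (exists_indicatorMul μ hE).choose

theorem indicatorMul_coeFn {E : Set X} (hE : MeasurableSet E) (h : Lp ℂ 2 μ) :
    indicatorMul μ hE h =ᵐ[μ] E.indicator h := (exists_indicatorMul μ hE).choose_spec h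

theorem indicatorMul_mul {E G : Set X} (hE : MeasurableSet E) (hG : MeasurableSet G) :
    indicatorMul μ hE * indicatorMul μ hG = indicatorMul μ (hE.inter hG) := by
  ext1 h
  ext1
  change indicatorMul μ hE (indicatorMul μ hG h) =ᵐ[μ] _
  filter_upwards [indicatorMul_coeFn hE (indicatorMul μ hG h), indicatorMul_coeFn hG h,
    indicatorMul_coeFn (hE.inter hG) h] with x h1 h2 h3
  rw [h1, h3, ← Set.indicator_indicator]
  by_cases hx : x ∈ E
  · rw [Set.indicator_of_mem hx, Set.indicator_of_mem hx, h2]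
  · rw [Set.indicator_of_notMem hx, Set.indicator_of_notMem hx]

theorem star_indicatorMul {E : Set X} (hE : MeasurableSet E) :
    star (indicatorMul μ hE) = indicatorMul μ hE := by
  rw [ContinuousLinearMap.star_eq_adjoint]
  symm
  rw [ContinuousLinearMap.eq_adjoint_iff]
  intro f g
  rw [L2.inner_def, L2.inner_def]
  refine integral_congr_ae ?_
  filter_upwards [indicatorMul_coeFn hE f, indicatorMul_coeFn hE g] with x h1 h2
  rw [h1, h2]
  by_cases hx : x ∈ E <;> simp [hx]

theorem indicatorMul_indicatorConstLp {E G : Set X} (hE : MeasurableSet E) (hG : MeasurableSet G)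
    (hμ : μ G ≠ ∞) (hμ' : μ (E ∩ G) ≠ ∞) (c : ℂ) :
    indicatorMul μ hE (indicatorConstLp 2 hG hμ c) = indicatorConstLp 2 (hE.inter hG) hμ' c := by
  ext1
  filter_upwards [indicatorMul_coeFn hE (indicatorConstLp 2 hG hμ c),
    indicatorConstLp_coeFn (p := 2) (hs := hG) (hμs := hμ) (c := c),
    indicatorConstLp_coeFn (p := 2) (hs := hE.inter hG) (hμs := hμ') (c := c)] with x h1 h2 h3
  rw [h1, h3, ← Set.indicator_indicator]
  by_cases hx : x ∈ E
  · rw [Set.indicator_of_mem hx, Set.indicator_of_mem hx, h2]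
  · rw [Set.indicator_of_notMem hx, Set.indicator_of_notMem hx]

end WeightedComposition

namespace KGraph

variable {k : ℕ} {V : Type u} [SmallCategory V] {Λ : KGraph k V}

/-! ### Cylinder functions in `L²` -/

namespace InfinitePath

/-- The functions `1_{Z(l)} g` span a dense subspace of `L²` when `g` is nonzero almost
everywhere. -/
theorem span_indicator_cylinder (hfin : Λ.RowFinite) {μ : Measure Λ.InfinitePath}
    {g : Λ.InfinitePath → ℂ} (hg : ∀ᵐ x ∂μ, g x ≠ 0) (u : Arrow V → Lp ℂ 2 μ)
    (hu : ∀ l, u l =ᵐ[μ] (cylinder Λ l).indicator g) :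
    (Submodule.span ℂ (Set.range u)).topologicalClosure = ⊤ := by
  rw [Submodule.topologicalClosure_eq_top_iff, Submodule.eq_bot_iff]
  intro f hf
  have h1 : ∀ l, (fun x => inner ℂ (u l x) (f x)) =ᵐ[μ]
      (cylinder Λ l).indicator fun x => inner ℂ (g x) (f x) := by
    intro l
    filter_upwards [hu l] with x hx
    rw [hx]
    by_cases h : x ∈ cylinder Λ l <;> simp [h]
  -- For `f` orthogonal to every `u l`, the function `conj g · f` has zero integral over each
  -- cylinder; it vanishes almost everywhere, and so does `f`, since `g` does not.
  have h2 := ae_eq_zero_of_setIntegral_cylinder hfin (μ := μ)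
    (f := fun x => inner ℂ (g x) (f x)) (fun v => ?_) fun l => ?_
  · rw [Lp.eq_zero_iff_ae_eq_zero]
    filter_upwards [h2, hg] with x h3 h4
    simpa [h4] using h3
  · rw [← integrable_indicator_iff (measurableSet_vertexCylinder v)]
    exact (L2.integrable_inner (𝕜 := ℂ) (u (Arrow.mk (𝟙 v))) f).congr (h1 _)
  · rw [← integral_indicator (measurableSet_cylinder l), ← integral_congr_ae (h1 l),
      ← L2.inner_def]
    exact (Submodule.mem_orthogonal _ _).1 hf _ (Submodule.subset_span ⟨l, rfl⟩)

variable (Λ) in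
/-- Multiplication by the indicator function of a cylinder. -/
noncomputable abbrev cylinderMul (μ : Measure Λ.InfinitePath) (l : Arrow V) :
    Lp ℂ 2 μ →L[ℂ] Lp ℂ 2 μ := indicatorMul μ (measurableSet_cylinder l)

/-- The indicator function of a cylinder as an element of `L²`. -/
noncomputable abbrev cylinderOne {μ : Measure Λ.InfinitePath}
    (hμ : ∀ l, μ (cylinder Λ l) ≠ ∞) (l : Arrow V) : Lp ℂ 2 μ :=
  indicatorConstLp 2 (measurableSet_cylinder l) (hμ l) (1 : ℂ)

theorem span_cylinderOne (hfin : Λ.RowFinite) {μ : Measure Λ.InfinitePath}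
    (hμ : ∀ l, μ (cylinder Λ l) ≠ ∞) :
    (Submodule.span ℂ (Set.range (cylinderOne hμ))).topologicalClosure = ⊤ :=
  span_indicator_cylinder hfin (g := fun _ => 1) (by simp) _ fun _ => indicatorConstLp_coeFn

theorem cylinderMul_cylinderOne (hfin : Λ.RowFinite) {μ : Measure Λ.InfinitePath}
    (hμ : ∀ l, μ (cylinder Λ l) ≠ ∞) (l m : Arrow V) :
    cylinderMul Λ μ l (cylinderOne hμ m) = ∑ c ∈ commonExtensions hfin l m, cylinderOne hμ c := by
  classical
  have h0 : ∀ S : Finset (Arrow V), ⇑(∑ c ∈ S, cylinderOne hμ c : Lp ℂ 2 μ) =ᵐ[μ]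
      fun x => ∑ c ∈ S, (cylinder Λ c).indicator (fun _ => (1 : ℂ)) x := by
    intro S
    induction S using Finset.induction_on with
    | empty =>
      simp only [Finset.sum_empty]
      exact Lp.coeFn_zero _ _ _
    | insert a S ha ih =>
      simp only [Finset.sum_insert ha]
      filter_upwards [Lp.coeFn_add (cylinderOne hμ a) (∑ c ∈ S, cylinderOne hμ c), ih,
        indicatorConstLp_coeFn (p := 2) (hs := measurableSet_cylinder a) (hμs := hμ a)
          (c := (1 : ℂ))] with x h1 h2 h3
      rw [h1, Pi.add_apply, h2, h3]
  ext1
  filter_upwards [h0 (commonExtensions hfin l m),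
    indicatorMul_coeFn (measurableSet_cylinder l) (cylinderOne hμ m),
    indicatorConstLp_coeFn (p := 2) (hs := measurableSet_cylinder m) (hμs := hμ m)
      (c := (1 : ℂ))] with x h1 h2 h3
  rw [h1, h2]
  have h4 : (cylinder Λ l).indicator (cylinderOne hμ m) x =
      (cylinder Λ l ∩ cylinder Λ m).indicator (fun _ => (1 : ℂ)) x := by
    rw [← Set.indicator_indicator]
    by_cases hx : x ∈ cylinder Λ l
    · rw [Set.indicator_of_mem hx, Set.indicator_of_mem hx, h3]
    · rw [Set.indicator_of_notMem hx, Set.indicator_of_notMem hx]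
  rw [h4, cylinder_inter_cylinder hfin,
    Finset.indicator_biUnion_apply _ _ (pairwiseDisjoint_cylinder degree_of_mem_commonExtensions)]

theorem inner_cylinderOne (hfin : Λ.RowFinite) {μ : Measure Λ.InfinitePath}
    (hμ : ∀ l, μ (cylinder Λ l) ≠ ∞) (l m : Arrow V) :
    inner ℂ (cylinderOne hμ l) (cylinderOne hμ m) =
      ∑ c ∈ commonExtensions hfin l m, ((μ.real (cylinder Λ c) : ℝ) : ℂ) := by
  rw [L2.inner_indicatorConstLp_one, setIntegral_congr_ae (measurableSet_cylinder l)
    (g := (cylinder Λ m).indicator fun _ => (1 : ℂ))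
    (indicatorConstLp_coeFn.mono fun x hx _ => hx),
    setIntegral_indicator (measurableSet_cylinder m), cylinder_inter_cylinder hfin,
    setIntegral_const, measureReal_biUnion_finset
      (pairwiseDisjoint_cylinder degree_of_mem_commonExtensions)
      (fun c _ => measurableSet_cylinder c) fun c _ => hμ c]
  simp

end InfinitePath

open InfinitePath

variable {k : ℕ} {V : Type u} [SmallCategory V] {Λ : KGraph k V}

/-! ### The unitary onto `L²` of the measure of a monic vector -/

section Unitary

variable {H : Type*} [NormedAddCommGroup H] [InnerProductSpace ℂ H] [CompleteSpace H]
  {π : Λ.CStar →⋆ₙₐ[ℂ] (H →L[ℂ] H)}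

theorem IsMonicMeasure.cylinder_ne_top {ξ : H} {μ : Measure Λ.InfinitePath}
    (hμ : IsMonicMeasure π ξ μ) (l : Arrow V) : μ (cylinder Λ l) ≠ ∞ :=
  (hμ.cylinder_lt_top l).ne

theorem IsMonicVector.exists_unitary (hfin : Λ.RowFinite) {ξ : H} (hξ : IsMonicVector π ξ)
    {μ : Measure Λ.InfinitePath} (hμ : IsMonicMeasure π ξ μ) :
    ∃ U : H ≃ₗᵢ[ℂ] Lp ℂ 2 μ, ∀ l, U ((π (Λ.gen l) * star (π (Λ.gen l))) ξ) =
      cylinderOne hμ.cylinder_ne_top l := by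
  refine exists_linearIsometryEquiv_of_inner_eq _ _ hξ
    (span_cylinderOne hfin hμ.cylinder_ne_top) fun l m => ?_
  rw [inner_cylinderOne hfin, (isCuntzKrieger_map_gen hfin π).inner_proj_proj hfin]
  refine Finset.sum_congr rfl fun c _ => ?_
  rw [measureReal_def, (isMonicMeasure_iff hfin).1 hμ c, ENNReal.toReal_ofReal (sq_nonneg _)]

/-- The transport of a representation along a unitary. -/
noncomputable def conjRep {K : Type*} [NormedAddCommGroup K] [InnerProductSpace ℂ K]
    [CompleteSpace K] (π : Λ.CStar →⋆ₙₐ[ℂ] (H →L[ℂ] H)) (U : H ≃ₗᵢ[ℂ] K) :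
    Λ.CStar →⋆ₙₐ[ℂ] (K →L[ℂ] K) :=
  { toFun := fun a => U.conjStarAlgEquiv (π a)
    map_smul' := fun c a => by simp only [map_smul, MonoidHom.id_apply]
    map_zero' := by rw [map_zero, map_zero]
    map_add' := fun a b => by rw [map_add, map_add]
    map_mul' := fun a b => by rw [map_mul, map_mul]
    map_star' := fun a => by rw [map_star, map_star] }

theorem conjRep_apply {K : Type*} [NormedAddCommGroup K] [InnerProductSpace ℂ K]
    [CompleteSpace K] (U : H ≃ₗᵢ[ℂ] K) (a : Λ.CStar) :
    conjRep π U a = U.conjStarAlgEquiv (π a) := rfl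

theorem conjRep_proj {K : Type*} [NormedAddCommGroup K] [InnerProductSpace ℂ K]
    [CompleteSpace K] (U : H ≃ₗᵢ[ℂ] K) (a : Λ.CStar) (x : H) :
    (conjRep π U a * star (conjRep π U a)) (U x) = U ((π a * star (π a)) x) := by
  rw [conjRep_apply, ← map_star, ← map_mul, LinearIsometryEquiv.conjStarAlgEquiv_apply_apply,
    LinearIsometryEquiv.symm_apply_apply]

/-- Both sides are bounded and send `1_{Z(m)}` to the sum of `1_{Z(c)}` over the common extensions
`c` of `l` and `m`; these indicators are total. -/
theorem conjRep_proj_eq_cylinderMul (hfin : Λ.RowFinite) {ξ : H} {μ : Measure Λ.InfinitePath}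
    (hμ : IsMonicMeasure π ξ μ) {U : H ≃ₗᵢ[ℂ] Lp ℂ 2 μ}
    (hU : ∀ l, U ((π (Λ.gen l) * star (π (Λ.gen l))) ξ) = cylinderOne hμ.cylinder_ne_top l)
    (l : Arrow V) : conjRep π U (Λ.gen l) * star (conjRep π U (Λ.gen l)) = cylinderMul Λ μ l := by
  refine ContinuousLinearMap.ext_on (s := Set.range (cylinderOne hμ.cylinder_ne_top))
    (Submodule.dense_iff_topologicalClosure_eq_top.2
      (span_cylinderOne hfin hμ.cylinder_ne_top)) ?_
  rintro _ ⟨m, rfl⟩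
  rw [cylinderMul_cylinderOne hfin, ← hU m, conjRep_proj]
  change U ((π (Λ.gen l) * star (π (Λ.gen l)) * (π (Λ.gen m) * star (π (Λ.gen m)))) ξ) = _
  rw [(isCuntzKrieger_map_gen hfin π).proj_mul_proj hfin, _root_.sum_apply, map_sum]
  exact Finset.sum_congr rfl fun c _ => hU c

end Unitary

/-! ### Representations on `L²` whose range projections multiply by cylinders -/

section Standard

variable {μ : Measure Λ.InfinitePath} {ρ : Λ.CStar →⋆ₙₐ[ℂ] (Lp ℂ 2 μ →L[ℂ] Lp ℂ 2 μ)}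

/-- The function `ρ(s_l) 1_{Z(s(l))}`. -/
noncomputable def weight (hμ : ∀ l, μ (cylinder Λ l) ≠ ∞)
    (ρ : Λ.CStar →⋆ₙₐ[ℂ] (Lp ℂ 2 μ →L[ℂ] Lp ℂ 2 μ)) (l : Arrow V) : Lp ℂ 2 μ :=
  ρ (Λ.gen l) (cylinderOne hμ (Arrow.mk (𝟙 l.left)))

theorem cylinderMul_vertex {hμ : ∀ l, μ (cylinder Λ l) ≠ ∞} {m : Arrow V} {v : V}
    (hm : m.right = v) :
    cylinderMul Λ μ m (cylinderOne hμ (Arrow.mk (𝟙 v))) = cylinderOne hμ m := by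
  subst hm
  have h : cylinder Λ m ∩ cylinder Λ (Arrow.mk (𝟙 m.right)) = cylinder Λ m :=
    Set.inter_eq_left.2 (cylinder_subset_vertexCylinder m)
  rw [cylinderMul, indicatorMul_indicatorConstLp _ _ _ (by rw [h]; exact hμ m)]
  simp only [h]

theorem cylinderMul_vertex_of_ne {hμ : ∀ l, μ (cylinder Λ l) ≠ ∞} {m : Arrow V} {v : V}
    (hm : m.right ≠ v) : cylinderMul Λ μ (Arrow.mk (𝟙 v)) (cylinderOne hμ m) = 0 := by
  have h : cylinder Λ (Arrow.mk (𝟙 v)) ∩ cylinder Λ m = ∅ := by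
    refine Set.eq_empty_of_forall_notMem fun x hx => hm ?_
    rw [← range_eq_of_mem_cylinder hx.2]
    exact mem_vertexCylinder.1 hx.1
  rw [cylinderMul, indicatorMul_indicatorConstLp _ _ _ (by rw [h]; simp)]
  simp only [h, indicatorConstLp_empty]

theorem cylinderMul_vertex_self {hμ : ∀ l, μ (cylinder Λ l) ≠ ∞} (m : Arrow V) :
    cylinderMul Λ μ (Arrow.mk (𝟙 m.right)) (cylinderOne hμ m) = cylinderOne hμ m := by
  have h : cylinder Λ (Arrow.mk (𝟙 m.right)) ∩ cylinder Λ m = cylinder Λ m :=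
    Set.inter_eq_right.2 (cylinder_subset_vertexCylinder m)
  rw [cylinderMul, indicatorMul_indicatorConstLp _ _ _ (by rw [h]; exact hμ m)]
  simp only [h]

theorem vertex_eq_cylinderMul (hfin : Λ.RowFinite)
    (hρ : ∀ l, ρ (Λ.gen l) * star (ρ (Λ.gen l)) = cylinderMul Λ μ l) (v : V) :
    ρ (Λ.gen (Arrow.mk (𝟙 v))) = cylinderMul Λ μ (Arrow.mk (𝟙 v)) := by
  have h := (isCuntzKrieger_map_gen hfin ρ).vertex_proj v
  rw [← hρ, h.isSelfAdjoint.star_eq, h.isIdempotentElem.eq]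

theorem gen_ae_eq_indicator (hfin : Λ.RowFinite)
    (hρ : ∀ l, ρ (Λ.gen l) * star (ρ (Λ.gen l)) = cylinderMul Λ μ l) (l : Arrow V)
    (h : Lp ℂ 2 μ) : ρ (Λ.gen l) h =ᵐ[μ] (cylinder Λ l).indicator (ρ (Λ.gen l) h) := by
  have h1 : cylinderMul Λ μ l (ρ (Λ.gen l) h) = ρ (Λ.gen l) h := by
    rw [← hρ]
    exact DFunLike.congr_fun ((isCuntzKrieger_map_gen hfin ρ).partialIsometry l) h
  have h2 := indicatorMul_coeFn (measurableSet_cylinder l) (ρ (Λ.gen l) h)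
  rwa [show indicatorMul μ _ _ = _ from h1] at h2

/-- If `m` starts at the source of `l`, then `1_{Z(m)}` is cut out of `1_{Z(s(l))}` by the
projection of `m`, and `mul_proj` moves that projection through `ρ(s_l)`. Otherwise both sides
vanish. -/
theorem gen_cylinderOne (hfin : Λ.RowFinite)
    (hρ : ∀ l, ρ (Λ.gen l) * star (ρ (Λ.gen l)) = cylinderMul Λ μ l)
    (hμ : ∀ l, μ (cylinder Λ l) ≠ ∞) (l m : Arrow V) :
    ρ (Λ.gen l) (cylinderOne hμ m) =ᵐ[μ] fun x => weight hμ ρ l x *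
      (cylinder Λ m).indicator (fun _ => (1 : ℂ)) (x.shift (Λ.degree l)) := by
  have hck := isCuntzKrieger_map_gen hfin ρ
  have hw := gen_ae_eq_indicator hfin hρ l (cylinderOne hμ (Arrow.mk (𝟙 l.left)))
  by_cases hm : m.right = l.left
  · obtain ⟨c, hc⟩ := exists_isComp hm
    have h1 : ρ (Λ.gen l) (cylinderOne hμ m) = cylinderMul Λ μ c (weight hμ ρ l) := by
      rw [← cylinderMul_vertex hm, ← hρ m, ← hρ c]
      exact DFunLike.congr_fun (hck.mul_proj hc) _
    rw [h1]
    filter_upwards [indicatorMul_coeFn (measurableSet_cylinder c) (weight hμ ρ l), hw]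
      with x h2 h3
    rw [h2]
    by_cases hx : x ∈ cylinder Λ l
    · by_cases hxc : x ∈ cylinder Λ c
      · rw [Set.indicator_of_mem hxc,
          Set.indicator_of_mem ((shift_mem_cylinder_iff hc hx).2 hxc), mul_one]
      · rw [Set.indicator_of_notMem hxc,
          Set.indicator_of_notMem (fun h => hxc ((shift_mem_cylinder_iff hc hx).1 h)), mul_zero]
    · rw [Set.indicator_of_notMem fun h => hx (cylinder_subset_of_isPrefix hc.isPrefix h)]
      rw [Set.indicator_of_notMem hx] at h3
      rw [weight, h3, zero_mul]
  · have h1 : ρ (Λ.gen l) (cylinderOne hμ m) = 0 := by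
      have h2 := DFunLike.congr_fun (hck.mul_source l) (cylinderOne hμ m)
      rw [← h2]
      change ρ (Λ.gen l) (ρ (Λ.gen (Arrow.mk (𝟙 l.left))) (cylinderOne hμ m)) = 0
      rw [vertex_eq_cylinderMul hfin hρ, cylinderMul_vertex_of_ne hm, map_zero]
    rw [h1]
    filter_upwards [Lp.coeFn_zero ℂ 2 μ, hw] with x h2 h3
    rw [h2, Pi.zero_apply]
    by_cases hx : x ∈ cylinder Λ l
    · rw [Set.indicator_of_notMem, mul_zero]
      intro h4
      rw [← range_eq_of_mem_cylinder h4, range_shift_of_mem_cylinder hx] at hm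
      exact hm rfl
    · rw [Set.indicator_of_notMem hx] at h3
      rw [weight, h3, zero_mul]

theorem enorm_cylinderOne_sq (hμ : ∀ l, μ (cylinder Λ l) ≠ ∞) (m : Arrow V) :
    ‖cylinderOne hμ m‖ₑ ^ 2 = μ (cylinder Λ m) := by
  rw [Lp.enorm_def, eLpNorm_two_sq, ← lintegral_indicator_one (measurableSet_cylinder m)]
  refine lintegral_congr_ae ?_
  filter_upwards [indicatorConstLp_coeFn (p := 2) (hs := measurableSet_cylinder m)
    (hμs := hμ m) (c := (1 : ℂ))] with x hx
  rw [hx]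
  by_cases h : x ∈ cylinder Λ m <;> simp [h]

theorem norm_gen_apply (hfin : Λ.RowFinite) (l : Arrow V) {h : Lp ℂ 2 μ}
    (hh : ρ (Λ.gen (Arrow.mk (𝟙 l.left))) h = h) : ‖ρ (Λ.gen l) h‖ = ‖h‖ := by
  have h1 : inner ℂ (ρ (Λ.gen l) h) (ρ (Λ.gen l) h) = inner ℂ h h := by
    rw [← ContinuousLinearMap.adjoint_inner_right, ← ContinuousLinearMap.star_eq_adjoint]
    change inner ℂ h ((star (ρ (Λ.gen l)) * ρ (Λ.gen l)) h) = _
    rw [(isCuntzKrieger_map_gen hfin ρ).star_mul l, hh]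
  rw [@norm_eq_sqrt_re_inner ℂ, @norm_eq_sqrt_re_inner ℂ, h1]

/-- The measure `|F_l|² μ`. -/
noncomputable def weightMeasure (hμ : ∀ l, μ (cylinder Λ l) ≠ ∞)
    (ρ : Λ.CStar →⋆ₙₐ[ℂ] (Lp ℂ 2 μ →L[ℂ] Lp ℂ 2 μ)) (l : Arrow V) : Measure Λ.InfinitePath :=
  μ.withDensity fun x => ‖weight hμ ρ l x‖ₑ ^ 2

theorem measurable_weight (hμ : ∀ l, μ (cylinder Λ l) ≠ ∞) (l : Arrow V) :
    Measurable (weight hμ ρ l) := (Lp.stronglyMeasurable _).measurable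

/-- By `gen_cylinderOne` the left side gives `Z(m)` the mass `‖ρ(s_l) 1_{Z(m)}‖²`. The operator
`ρ(s_l)` preserves the norm of `1_{Z(m)}` when `m` starts at the source of `l` and kills it
otherwise, so this is `μ(Z(m) ∩ Z(s(l)))`. -/
theorem map_weightMeasure (hfin : Λ.RowFinite)
    (hρ : ∀ l, ρ (Λ.gen l) * star (ρ (Λ.gen l)) = cylinderMul Λ μ l)
    (hμ : ∀ l, μ (cylinder Λ l) ≠ ∞) (l : Arrow V) :
    (weightMeasure hμ ρ l).map (shift (Λ.degree l)) =
      μ.restrict (vertexCylinder Λ l.left) := by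
  have key : ∀ m, (weightMeasure hμ ρ l).map (shift (Λ.degree l)) (cylinder Λ m) =
      ‖ρ (Λ.gen l) (cylinderOne hμ m)‖ₑ ^ 2 := by
    intro m
    have hm := measurableSet_cylinder (Λ := Λ) m
    rw [Lp.enorm_def, eLpNorm_two_sq, lintegral_congr_ae
      ((gen_cylinderOne hfin hρ hμ l m).mono fun x hx => by rw [hx]),
      lintegral_enorm_mul_comp_sq (measurable_weight hμ l) (measurable_shift _)
        (measurable_const.indicator hm), ← lintegral_indicator_one hm]
    refine lintegral_congr fun x => ?_
    by_cases h : x ∈ cylinder Λ m <;> simp [h]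
  have key2 : ∀ m, (weightMeasure hμ ρ l).map (shift (Λ.degree l)) (cylinder Λ m) =
      μ.restrict (vertexCylinder Λ l.left) (cylinder Λ m) := by
    intro m
    rw [key, Measure.restrict_apply (measurableSet_cylinder m)]
    by_cases hm : m.right = l.left
    · have h1 : ‖ρ (Λ.gen l) (cylinderOne hμ m)‖ = ‖cylinderOne hμ m‖ := by
        refine norm_gen_apply hfin l ?_
        rw [vertex_eq_cylinderMul hfin hρ, ← hm, cylinderMul_vertex_self]
      rw [← ofReal_norm, h1, ofReal_norm, enorm_cylinderOne_sq,
        Set.inter_eq_left.2]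
      rw [← hm]
      exact cylinder_subset_vertexCylinder m
    · have h1 : ρ (Λ.gen l) (cylinderOne hμ m) = 0 := by
        have h2 := DFunLike.congr_fun ((isCuntzKrieger_map_gen hfin ρ).mul_source l)
          (cylinderOne hμ m)
        rw [← h2]
        change ρ (Λ.gen l) (ρ (Λ.gen (Arrow.mk (𝟙 l.left))) (cylinderOne hμ m)) = 0
        rw [vertex_eq_cylinderMul hfin hρ, cylinderMul_vertex_of_ne hm, map_zero]
      have h2 : cylinder Λ m ∩ vertexCylinder Λ l.left = ∅ := by
        refine Set.eq_empty_of_forall_notMem fun x hx => hm ?_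
        rw [← range_eq_of_mem_cylinder hx.1]
        exact mem_vertexCylinder.1 hx.2
      rw [h1, h2]
      simp
  refine measure_ext_of_cylinder hfin key2 fun v => ?_
  rw [vertexCylinder, key]
  exact ENNReal.pow_ne_top enorm_ne_top

theorem map_weightMeasure_le (hfin : Λ.RowFinite)
    (hρ : ∀ l, ρ (Λ.gen l) * star (ρ (Λ.gen l)) = cylinderMul Λ μ l)
    (hμ : ∀ l, μ (cylinder Λ l) ≠ ∞) (l : Arrow V) :
    (weightMeasure hμ ρ l).map (shift (Λ.degree l)) ≤ μ := by
  rw [map_weightMeasure hfin hρ]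
  exact Measure.restrict_le_self

/-- The pushforward bound makes `h ↦ F_l · (h ∘ σ^{d(l)})` a bounded operator, so agreement with
`ρ(s_l)` on the total set of indicators suffices. -/
theorem arisesFrom_weight (hfin : Λ.RowFinite)
    (hρ : ∀ l, ρ (Λ.gen l) * star (ρ (Λ.gen l)) = cylinderMul Λ μ l)
    (hμ : ∀ l, μ (cylinder Λ l) ≠ ∞) : ArisesFrom (weight hμ ρ) ρ := by
  intro l h
  obtain ⟨S, hS⟩ := exists_weightedComp (measurable_weight (ρ := ρ) hμ l)
    (measurable_shift (Λ.degree l)) (map_weightMeasure_le hfin hρ hμ l)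
  have h1 : ρ (Λ.gen l) = S := by
    refine ContinuousLinearMap.ext_on (s := Set.range (cylinderOne hμ))
      (Submodule.dense_iff_topologicalClosure_eq_top.2 (span_cylinderOne hfin hμ)) ?_
    rintro _ ⟨m, rfl⟩
    ext1
    filter_upwards [gen_cylinderOne hfin hρ hμ l m, hS (cylinderOne hμ m),
      ae_eq_zero_or_of_map_le (measurable_weight (ρ := ρ) hμ l) (measurable_shift (Λ.degree l))
        (map_weightMeasure_le hfin hρ hμ l) (indicatorConstLp_coeFn (p := 2)
          (hs := measurableSet_cylinder m) (hμs := hμ m) (c := (1 : ℂ)))] with x h2 h3 h4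
    rw [h2, h3]
    rcases h4 with h4 | h4
    · rw [h4, zero_mul, zero_mul]
    · rw [h4]
  rw [h1]
  exact hS h

/-- `1_{Z(l)}` lies in the range of `ρ(s_l)` and is therefore a multiple of `F_l`, which leaves no
room for zeros on `Z(l)`. -/
theorem weight_ae_ne_zero (hfin : Λ.RowFinite)
    (hρ : ∀ l, ρ (Λ.gen l) * star (ρ (Λ.gen l)) = cylinderMul Λ μ l)
    (hμ : ∀ l, μ (cylinder Λ l) ≠ ∞) (l : Arrow V) :
    ∀ᵐ x ∂μ, x ∈ cylinder Λ l ↔ weight hμ ρ l x ≠ 0 := by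
  have h1 : ρ (Λ.gen l) (star (ρ (Λ.gen l)) (cylinderOne hμ l)) =
      cylinderMul Λ μ l (cylinderOne hμ l) := by
    rw [← hρ]
    rfl
  filter_upwards [arisesFrom_weight hfin hρ hμ l (star (ρ (Λ.gen l)) (cylinderOne hμ l)),
    indicatorMul_coeFn (measurableSet_cylinder l) (cylinderOne hμ l),
    indicatorConstLp_coeFn (p := 2) (hs := measurableSet_cylinder l) (hμs := hμ l) (c := (1 : ℂ)),
    gen_ae_eq_indicator hfin hρ l (cylinderOne hμ (Arrow.mk (𝟙 l.left)))] with x h2 h3 h4 h5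
  constructor
  · intro hx h0
    rw [h1, show (cylinderMul Λ μ l (cylinderOne hμ l)) x = _ from h3, Set.indicator_of_mem hx,
      h4, Set.indicator_of_mem hx, h0, zero_mul] at h2
    exact one_ne_zero h2
  · intro h0
    by_contra hx
    rw [Set.indicator_of_notMem hx] at h5
    exact h0 h5

theorem lintegral_weight (hfin : Λ.RowFinite)
    (hρ : ∀ l, ρ (Λ.gen l) * star (ρ (Λ.gen l)) = cylinderMul Λ μ l)
    (hμ : ∀ l, μ (cylinder Λ l) ≠ ∞) (l : Arrow V) {E : Set Λ.InfinitePath}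
    (hE : MeasurableSet E) : μ (vertexCylinder Λ l.left ∩ prefixMap l ⁻¹' E) =
      ∫⁻ x in E, ‖weight hμ ρ l x‖ₑ ^ 2 ∂μ := by
  have hm : MeasurableSet (prefixMap l ⁻¹' E) := measurable_prefixMap l hE
  rw [Set.inter_comm, ← Measure.restrict_apply hm, ← map_weightMeasure hfin hρ hμ l,
    Measure.map_apply (measurable_shift _) hm, weightMeasure,
    withDensity_apply _ (measurable_shift _ hm), ← lintegral_indicator hE,
    ← lintegral_indicator (measurable_shift _ hm)]
  refine lintegral_congr_ae ?_
  filter_upwards [weight_ae_ne_zero hfin hρ hμ l] with x hx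
  by_cases h : x ∈ cylinder Λ l
  · have h1 : x ∈ shift (Λ.degree l) ⁻¹' (prefixMap l ⁻¹' E) ↔ x ∈ E := by
      rw [Set.mem_preimage, Set.mem_preimage, prefixMap_shift h]
    by_cases h2 : x ∈ E
    · rw [Set.indicator_of_mem h2, Set.indicator_of_mem (h1.2 h2)]
    · rw [Set.indicator_of_notMem h2, Set.indicator_of_notMem (fun h3 => h2 (h1.1 h3))]
  · have h0 : weight hμ ρ l x = 0 := by
      by_contra h1
      exact h (hx.2 h1)
    simp [Set.indicator, h0]

/-- The derivative of `μ ∘ σ_l` is the reciprocal of `|F_l|² ∘ σ_l`: pull the integral back along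
`σ^{d(l)}` and cancel, as `F_l` is nonzero almost everywhere on `Z(l)`. -/
theorem measure_image_prefixMap (hfin : Λ.RowFinite)
    (hρ : ∀ l, ρ (Λ.gen l) * star (ρ (Λ.gen l)) = cylinderMul Λ μ l)
    (hμ : ∀ l, μ (cylinder Λ l) ≠ ∞) (l : Arrow V) {E : Set Λ.InfinitePath}
    (hE : MeasurableSet E) (hEl : E ⊆ vertexCylinder Λ l.left) :
    μ (prefixMap l '' E) = ∫⁻ x in E, (‖weight hμ ρ l (prefixMap l x)‖ₑ ^ 2)⁻¹ ∂μ := by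
  have hw := measurable_weight (ρ := ρ) hμ l
  have hp := measurable_prefixMap (Λ := Λ) l
  have hs := measurable_shift (Λ := Λ) (Λ.degree l)
  have hi : prefixMap l '' E = cylinder Λ l ∩ shift (Λ.degree l) ⁻¹' E := by
    ext y
    constructor
    · rintro ⟨x, hx, rfl⟩
      have h1 := mem_vertexCylinder.1 (hEl hx)
      exact ⟨prefixMap_mem_cylinder h1, by rwa [Set.mem_preimage, shift_prefixMap h1]⟩
    · rintro ⟨hy, hy'⟩
      exact ⟨_, hy', prefixMap_shift hy⟩
  have hm := (measurableSet_cylinder (Λ := Λ) l).inter (hs hE)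
  have h1 : μ.restrict E = (μ.restrict (vertexCylinder Λ l.left)).restrict E := by
    rw [Measure.restrict_restrict hE, Set.inter_eq_left.2 hEl]
  rw [h1, ← map_weightMeasure hfin hρ hμ l, Measure.restrict_map hs hE,
    lintegral_map (by fun_prop) hs, weightMeasure, restrict_withDensity (hs hE),
    lintegral_withDensity_eq_lintegral_mul _ (by fun_prop) (by fun_prop), hi,
    ← lintegral_indicator_one hm, ← lintegral_indicator (hs hE)]
  refine lintegral_congr_ae ?_
  filter_upwards [weight_ae_ne_zero hfin hρ hμ l] with x hx
  by_cases h : x ∈ cylinder Λ l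
  · by_cases h2 : x ∈ shift (Λ.degree l) ⁻¹' E
    · have h1 : x ∈ cylinder Λ l ∩ shift (Λ.degree l) ⁻¹' E := ⟨h, h2⟩
      rw [Set.indicator_of_mem h1, Set.indicator_of_mem h2, Pi.mul_apply, prefixMap_shift h,
        ENNReal.mul_inv_cancel, Pi.one_apply]
      · simpa using hx.1 h
      · exact ENNReal.pow_ne_top enorm_ne_top
    · have h1 : x ∉ cylinder Λ l ∩ shift (Λ.degree l) ⁻¹' E := fun h3 => h2 h3.2
      rw [Set.indicator_of_notMem h2, Set.indicator_of_notMem h1]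
  -- Off `Z(l)` the density is `0` and annihilates the reciprocal, even where that is `∞`.
  · have h0 : weight hμ ρ l x = 0 := by
      by_contra h1
      exact h (hx.2 h1)
    have h1 : x ∉ cylinder Λ l ∩ shift (Λ.degree l) ⁻¹' E := fun h3 => h h3.1
    rw [Set.indicator_of_notMem h1]
    simp [Set.indicator, h0]

theorem isStandardProjective_weight (hfin : Λ.RowFinite)
    (hρ : ∀ l, ρ (Λ.gen l) * star (ρ (Λ.gen l)) = cylinderMul Λ μ l)
    (hne : ∀ l, ρ (Λ.gen l) ≠ 0) (hμ : ∀ l, μ (cylinder Λ l) ≠ ∞) :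
    Λ.IsStandardProjective μ (weight hμ ρ) where
  isLambdaSemibranching :=
    { semibranching := fun m =>
        { measurableSet_dom := fun l => measurableSet_vertexCylinder _
          dom_pos := fun l => by
            -- If `Z(s(l))` were null, the vertex generator, which multiplies by its indicator,
            -- would be zero.
            refine pos_iff_ne_zero.2 fun h0 => hne (Arrow.mk (𝟙 l.1.left)) ?_
            rw [vertex_eq_cylinderMul hfin hρ]
            ext1 h
            ext1
            filter_upwards [indicatorMul_coeFn (measurableSet_vertexCylinder l.1.left) h,
              Lp.coeFn_zero ℂ 2 μ, measure_eq_zero_iff_ae_notMem.1 h0] with x h1 h2 h3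
            rw [show (cylinderMul Λ μ (Arrow.mk (𝟙 l.1.left)) h) x = _ from h1,
              Set.indicator_of_notMem h3]
            exact h2.symm
          dom_lt_top := fun l => (hμ _).lt_top
          measurable_map := fun l => (measurable_prefixMap l.1).comp measurable_subtype_coe
          measurableSet_range := fun l => by
            rw [image_prefixMap]
            exact measurableSet_cylinder _
          range_cover := by
            have : ⋃ l : {l : Arrow V // Λ.degree l = m},
                prefixMap l.1 '' vertexCylinder Λ l.1.left = Set.univ := by
              refine Set.eq_univ_of_forall fun x => Set.mem_iUnion.2
                ⟨⟨x.seg m, x.degree_seg m⟩, ?_⟩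
              rw [image_prefixMap]
              exact x.mem_cylinder_seg m
            rw [this, Set.compl_univ, measure_empty]
          range_disjoint := fun l l' hl => by
            rw [image_prefixMap, image_prefixMap, Set.disjoint_iff_inter_eq_empty.1, measure_empty]
            exact Set.disjoint_left.2 fun x h1 h2 => hl (Subtype.ext
              (eq_of_mem_cylinder h1 h2 (l.2.trans l'.2.symm)))
          range_lt_top := fun l => by
            rw [image_prefixMap]
            exact (hμ _).lt_top
          rnDeriv_pos := fun l => by
            have hw := measurable_weight (ρ := ρ) hμ l.1
            have hp := measurable_prefixMap (Λ := Λ) l.1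
            refine ⟨fun x => (‖weight hμ ρ l.1 (prefixMap l.1 x)‖ₑ ^ 2)⁻¹, by fun_prop,
              fun E hE hEl => measure_image_prefixMap hfin hρ hμ l.1 hE hEl,
              Filter.Eventually.of_forall fun x => ?_⟩
            -- The weight is finite at every point, so its reciprocal is positive everywhere.
            exact ENNReal.inv_pos.2 (ENNReal.pow_ne_top enorm_ne_top) }
      coding := fun m =>
        { measurable := measurable_shift m
          leftInvOn := fun l x hx => by
            have := shift_prefixMap (mem_vertexCylinder.1 hx)
            rwa [l.2] at this }
      vertex := fun v x hx => prefixMap_id (mem_vertexCylinder.1 hx)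
      range_subset := fun {t w v} g f => by
        rw [image_prefixMap, Set.sdiff_eq_empty.2, measure_empty]
        exact cylinder_subset_vertexCylinder (Arrow.mk g)
      dom_comp := fun g f => Filter.EventuallyEq.rfl
      comp := fun {t w v} g f => by
        filter_upwards [ae_restrict_mem (measurableSet_vertexCylinder t)] with x hx
        exact prefixMap_prefixMap (isComp_mk g f) (mem_vertexCylinder.1 hx)
      coding_add := fun m n => funext fun x => shift_shift x m n }
  ne_zero l h0 := hne l (by
    ext1 h
    ext1
    filter_upwards [arisesFrom_weight hfin hρ hμ l h, Lp.coeFn_zero ℂ 2 μ] with x h1 h2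
    rw [h1, h0, h2, Pi.zero_apply, zero_mul]
    exact h2.symm)
  rnDeriv_eq l E hE := lintegral_weight hfin hρ hμ l hE
  mul_comp {t w v} g f := by
    -- Evaluate `ρ(s_f) ρ(s_g) = ρ(s_{fg})` at `1_{Z(s(g))}`.
    have h1 := arisesFrom_weight hfin hρ hμ (Arrow.mk f) (weight hμ ρ (Arrow.mk g))
    have h2 : ρ (Λ.gen (Arrow.mk f)) (weight hμ ρ (Arrow.mk g)) = weight hμ ρ (Arrow.mk (g ≫ f)) :=
      DFunLike.congr_fun ((isCuntzKrieger_map_gen hfin ρ).mul g f) _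
    rw [h2] at h1
    exact h1.symm

end Standard

theorem IsMonic.exists_standardProjective {H : Type*} [NormedAddCommGroup H]
    [InnerProductSpace ℂ H] [CompleteSpace H] {π : Λ.CStar →⋆ₙₐ[ℂ] (H →L[ℂ] H)}
    (hfin : Λ.RowFinite) (hπ : IsMonic π) {ξ : H} (hξ : IsMonicVector π ξ)
    {μ : Measure Λ.InfinitePath} (hμ : IsMonicMeasure π ξ μ) :
    ∃ (F : Arrow V → Lp ℂ 2 μ) (ρ : Λ.CStar →⋆ₙₐ[ℂ] (Lp ℂ 2 μ →L[ℂ] Lp ℂ 2 μ)),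
      Λ.IsStandardProjective μ F ∧ ArisesFrom F ρ ∧ UnitarilyEquivalent π ρ := by
  obtain ⟨U, hU⟩ := hξ.exists_unitary hfin hμ
  have hρ := conjRep_proj_eq_cylinderMul hfin hμ hU
  refine ⟨weight hμ.cylinder_ne_top (conjRep π U), conjRep π U,
    isStandardProjective_weight hfin hρ (fun l h0 => hπ.1 l ?_) hμ.cylinder_ne_top,
    arisesFrom_weight hfin hρ hμ.cylinder_ne_top, U, fun a h => ?_⟩
  · rw [conjRep_apply] at h0
    exact U.conjStarAlgEquiv.injective (h0.trans (map_zero _).symm)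
  · rw [conjRep_apply, LinearIsometryEquiv.conjStarAlgEquiv_apply_apply,
      LinearIsometryEquiv.symm_apply_apply]

/-! ### Representations arising from projective systems -/

section Converse

variable {μ : Measure Λ.InfinitePath} {F : Arrow V → Lp ℂ 2 μ}
  {ρ : Λ.CStar →⋆ₙₐ[ℂ] (Lp ℂ 2 μ →L[ℂ] Lp ℂ 2 μ)}

theorem ae_enorm_sq_eq_zero_of_lintegral {X : Type*} [MeasurableSpace X] {μ : Measure X}
    {f : Lp ℂ 2 μ} {E : Set X} (hE : MeasurableSet E) (h : ∫⁻ x in E, ‖f x‖ₑ ^ 2 ∂μ = 0) :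
    ∀ᵐ x ∂μ, x ∈ E → f x = 0 := by
  have hf : Measurable f := (Lp.stronglyMeasurable f).measurable
  rw [lintegral_eq_zero_iff (by fun_prop)] at h
  filter_upwards [(ae_restrict_iff' hE).1 h] with x hx hxE
  simpa using hx hxE

/-- No point of `Z(s(l))` is carried by `σ_l` into the complement of `Z(l)`, so `|F_l|²` has
integral zero there. -/
theorem IsStandardProjective.ae_eq_zero (h : Λ.IsStandardProjective μ F) (l : Arrow V) :
    ∀ᵐ x ∂μ, x ∉ cylinder Λ l → F l x = 0 := by
  refine ae_enorm_sq_eq_zero_of_lintegral (E := (cylinder Λ l)ᶜ)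
    (measurableSet_cylinder l).compl ?_
  rw [← h.rnDeriv_eq l _ (measurableSet_cylinder l).compl]
  convert measure_empty (μ := μ)
  refine Set.eq_empty_of_forall_notMem fun x hx => hx.2 ?_
  exact prefixMap_mem_cylinder (mem_vertexCylinder.1 hx.1)

/-- Multiplicativity gives `F_v² = F_v`, so `F_v` takes the values `0` and `1`. Since `σ_v` is the
identity, the zero set of `F_v` in `Z(v)` has measure equal to the integral of `|F_v|²` over itself,
which is `0`. -/
theorem IsStandardProjective.vertex_ae_eq (h : Λ.IsStandardProjective μ F) (v : V) :
    F (Arrow.mk (𝟙 v)) =ᵐ[μ] (vertexCylinder Λ v).indicator 1 := by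
  have hm : Measurable (F (Arrow.mk (𝟙 v))) := (Lp.stronglyMeasurable _).measurable
  have hE : MeasurableSet (vertexCylinder Λ v ∩ {x | F (Arrow.mk (𝟙 v)) x = 0}) :=
    (measurableSet_vertexCylinder v).inter (hm (measurableSet_singleton 0))
  have h1 : μ (vertexCylinder Λ v ∩ {x | F (Arrow.mk (𝟙 v)) x = 0}) = 0 := by
    have h2 := h.rnDeriv_eq (Arrow.mk (𝟙 v)) _ hE
    have h3 : vertexCylinder Λ (Arrow.mk (𝟙 v)).left ∩ prefixMap (Arrow.mk (𝟙 v)) ⁻¹'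
        (vertexCylinder Λ v ∩ {x | F (Arrow.mk (𝟙 v)) x = 0}) =
        vertexCylinder Λ v ∩ {x | F (Arrow.mk (𝟙 v)) x = 0} := by
      ext x
      constructor
      · rintro ⟨hx, hx'⟩
        rwa [Set.mem_preimage, prefixMap_id (v := v) (mem_vertexCylinder.1 hx)] at hx'
      · intro hx
        refine ⟨hx.1, ?_⟩
        rwa [Set.mem_preimage, prefixMap_id (mem_vertexCylinder.1 hx.1)]
    rw [h3] at h2
    rw [h2]
    refine (setLIntegral_congr_fun hE (g := fun _ => 0) fun x hx => ?_).trans (by simp)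
    change ‖F (Arrow.mk (𝟙 v)) x‖ₑ ^ 2 = 0
    rw [hx.2]
    simp
  have h4 := h.mul_comp (𝟙 v) (𝟙 v)
  rw [Category.comp_id] at h4
  filter_upwards [h.ae_eq_zero (Arrow.mk (𝟙 v)), measure_eq_zero_iff_ae_notMem.1 h1, h4]
    with x h5 h6 h7
  by_cases hx : x ∈ vertexCylinder Λ v
  · rw [Set.indicator_of_mem hx, Pi.one_apply]
    rw [Λ.deg_id, shift_zero] at h7
    have h8 : F (Arrow.mk (𝟙 v)) x ≠ 0 := fun h9 => h6 ⟨hx, h9⟩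
    exact mul_left_cancel₀ h8 (h7.trans (mul_one _).symm)
  · rw [Set.indicator_of_notMem hx]
    exact h5 hx

theorem ArisesFrom.gen_vertex (hF : Λ.IsStandardProjective μ F) (h : ArisesFrom F ρ) (v : V) :
    ρ (Λ.gen (Arrow.mk (𝟙 v))) = cylinderMul Λ μ (Arrow.mk (𝟙 v)) := by
  ext1 f
  ext1
  filter_upwards [h (Arrow.mk (𝟙 v)) f, hF.vertex_ae_eq v,
    indicatorMul_coeFn (measurableSet_cylinder (Arrow.mk (𝟙 v))) f] with x h1 h2 h3
  rw [h1, h2, Λ.degree_id, shift_zero]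
  refine Eq.trans ?_ h3.symm
  change (vertexCylinder Λ v).indicator 1 x * f x = (vertexCylinder Λ v).indicator f x
  by_cases hx : x ∈ vertexCylinder Λ v <;> simp [hx]

theorem ArisesFrom.cylinderMul_mul (hF : Λ.IsStandardProjective μ F) (h : ArisesFrom F ρ)
    (l : Arrow V) : cylinderMul Λ μ l * ρ (Λ.gen l) = ρ (Λ.gen l) := by
  ext1 f
  ext1
  change cylinderMul Λ μ l (ρ (Λ.gen l) f) =ᵐ[μ] _
  filter_upwards [h l f, hF.ae_eq_zero l,
    indicatorMul_coeFn (measurableSet_cylinder l) (ρ (Λ.gen l) f)] with x h1 h2 h3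
  refine h3.trans ?_
  by_cases hx : x ∈ cylinder Λ l
  · rw [Set.indicator_of_mem hx]
  · rw [Set.indicator_of_notMem hx, h1, h2 hx, zero_mul]

/-- The functions in the range of `ρ(s_m)` live on `Z(m)`, so `p_m` kills functions on `Z(l)` when
`m ≠ l` has the degree of `l`. Expanding the vertex projection in that degree shows that `p_l` fixes
every function on `Z(l)`. -/
theorem ArisesFrom.proj_eq_cylinderMul (hfin : Λ.RowFinite) (hF : Λ.IsStandardProjective μ F)
    (h : ArisesFrom F ρ) (l : Arrow V) :
    ρ (Λ.gen l) * star (ρ (Λ.gen l)) = cylinderMul Λ μ l := by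
  have hck := isCuntzKrieger_map_gen hfin ρ
  have h1 : ∀ m, ρ (Λ.gen m) * star (ρ (Λ.gen m)) * cylinderMul Λ μ m =
      ρ (Λ.gen m) * star (ρ (Λ.gen m)) := by
    intro m
    have h2 := congrArg star (h.cylinderMul_mul hF m)
    rw [star_mul, star_indicatorMul] at h2
    rw [mul_assoc, h2]
  have h3 : ρ (Λ.gen (Arrow.mk (𝟙 l.right))) * cylinderMul Λ μ l = cylinderMul Λ μ l := by
    rw [h.gen_vertex hF, cylinderMul, indicatorMul_mul]
    have : cylinder Λ (Arrow.mk (𝟙 l.right)) ∩ cylinder Λ l = cylinder Λ l :=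
      Set.inter_eq_right.2 (cylinder_subset_vertexCylinder l)
    simp only [this]
  have h4 : ∀ m, Λ.degree m = Λ.degree l → m ≠ l →
      ρ (Λ.gen m) * star (ρ (Λ.gen m)) * cylinderMul Λ μ l = 0 := by
    intro m hm hml
    rw [← h1 m, mul_assoc, indicatorMul_mul]
    have h5 : cylinder Λ m ∩ cylinder Λ l = ∅ :=
      Set.eq_empty_of_forall_notMem fun x hx => hml (eq_of_mem_cylinder hx.1 hx.2 hm)
    have h6 : indicatorMul μ ((measurableSet_cylinder m).inter (measurableSet_cylinder l)) = 0 := by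
      ext1 f
      ext1
      filter_upwards [indicatorMul_coeFn (μ := μ)
        ((measurableSet_cylinder m).inter (measurableSet_cylinder l)) f, Lp.coeFn_zero ℂ 2 μ]
        with x h7 h8
      rw [h7]
      refine Eq.trans ?_ h8.symm
      rw [Set.indicator_of_notMem, Pi.zero_apply]
      rw [h5]
      exact Set.notMem_empty x
    rw [h6, mul_zero]
  rw [← h1 l, ← h3, hck.vertex_eq_sum l.right (Λ.degree l),
    finsum_mem_eq_finite_toFinset_sum _ (hfin _ _), Finset.sum_mul, Finset.sum_eq_single l]
  · rw [← mul_assoc, (hck.isStarProjection_mul_star l).isIdempotentElem.eq]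
  · intro m hm hml
    rw [Set.Finite.mem_toFinset] at hm
    exact h4 m hm.2 hml
  · intro hl
    rw [Set.Finite.mem_toFinset] at hl
    exact absurd ⟨rfl, rfl⟩ hl

/-- The initial projection of `ρ(s_l)` is multiplication by the indicator of `Z(s(l))`, a set of
positive measure. -/
theorem ArisesFrom.gen_ne_zero (hfin : Λ.RowFinite) (hF : Λ.IsStandardProjective μ F)
    (hμ : ∀ v, μ (vertexCylinder Λ v) < ∞) (h : ArisesFrom F ρ) (l : Arrow V) :
    ρ (Λ.gen l) ≠ 0 := by
  intro h0
  have hμ' : ∀ l, μ (cylinder Λ l) ≠ ∞ := fun l =>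
    ((measure_mono (cylinder_subset_vertexCylinder l)).trans_lt (hμ _)).ne
  have h1 := (isCuntzKrieger_map_gen hfin ρ).star_mul l
  rw [h0, mul_zero, h.gen_vertex hF] at h1
  have h2 := cylinderMul_vertex_self (hμ := hμ') (Arrow.mk (𝟙 l.left))
  change cylinderMul Λ μ (Arrow.mk (𝟙 l.left)) _ = _ at h2
  rw [← h1] at h2
  have h3 := enorm_cylinderOne_sq hμ' (Arrow.mk (𝟙 l.left))
  rw [← h2] at h3
  have h4 := (hF.isLambdaSemibranching.semibranching (Λ.degree l)).dom_pos ⟨l, rfl⟩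
  refine h4.ne ?_
  change _ = μ (cylinder Λ (Arrow.mk (𝟙 l.left)))
  rw [← h3]
  simp

theorem ArisesFrom.isMonic (hfin : Λ.RowFinite) (hF : Λ.IsStandardProjective μ F)
    (hμ : ∀ v, μ (vertexCylinder Λ v) < ∞) (h : ArisesFrom F ρ) : IsMonic ρ := by
  refine ⟨h.gen_ne_zero hfin hF hμ, ?_⟩
  have := sigmaFinite_of_vertexCylinder hμ
  -- As `μ` may be infinite, the constant `1` need not lie in `L²`. The square root of a strictly
  -- positive integrable function takes its place as monic vector.
  obtain ⟨g, hg, hgm, hgi⟩ := exists_pos_lintegral_lt_of_sigmaFinite μ one_ne_zero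
  have hmem : MemLp (fun x => ((Real.sqrt (g x) : ℝ) : ℂ)) 2 μ := by
    refine ⟨by fun_prop, ?_⟩
    have h0 : eLpNorm (fun x => ((Real.sqrt (g x) : ℝ) : ℂ)) 2 μ ^ 2 < ∞ := by
      rw [eLpNorm_two_sq]
      refine lt_of_le_of_lt (le_of_eq (lintegral_congr fun x => ?_)) (hgi.trans ENNReal.one_lt_top)
      rw [← ofReal_norm, Complex.norm_real, Real.norm_of_nonneg (Real.sqrt_nonneg _),
        ← ENNReal.ofReal_pow (Real.sqrt_nonneg _), Real.sq_sqrt (NNReal.coe_nonneg _),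
        ENNReal.ofReal_coe_nnreal]
    exact (ENNReal.pow_lt_top_iff.1 h0).resolve_right two_ne_zero
  refine ⟨hmem.toLp _, span_indicator_cylinder hfin (g := fun x => ((Real.sqrt (g x) : ℝ) : ℂ))
    (Filter.Eventually.of_forall fun x => ?_) _ fun l => ?_⟩
  · have := Real.sqrt_pos.2 (NNReal.coe_pos.2 (hg x))
    exact_mod_cast this.ne'
  · simp only [h.proj_eq_cylinderMul hfin hF]
    filter_upwards [indicatorMul_coeFn (measurableSet_cylinder l) (hmem.toLp _),
      hmem.coeFn_toLp] with x h1 h2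
    refine h1.trans ?_
    by_cases hx : x ∈ cylinder Λ l
    · rw [Set.indicator_of_mem hx, Set.indicator_of_mem hx, h2]
    · rw [Set.indicator_of_notMem hx, Set.indicator_of_notMem hx]

end Converse

end KGraph

/-! ### The two directions combined -/

theorem mainTheorem5 {k : ℕ} (hk : 1 ≤ k) {V : Type*} [SmallCategory V] (Λ : KGraph k V)
    (hfin : Λ.RowFinite) (hsrc : Λ.SourceFree) :
    (∀ (H : Type*) [NormedAddCommGroup H] [InnerProductSpace ℂ H] [CompleteSpace H]
        (π : Λ.CStar →⋆ₙₐ[ℂ] (H →L[ℂ] H)), KGraph.IsMonic π →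
      ∀ ξ : H, KGraph.IsMonicVector π ξ →
        ∃ μ : Measure Λ.InfinitePath, KGraph.IsMonicMeasure π ξ μ ∧
          (∀ μ' : Measure Λ.InfinitePath, KGraph.IsMonicMeasure π ξ μ' → μ' = μ) ∧
          ∃ (F : Arrow V → Lp ℂ 2 μ) (ρ : Λ.CStar →⋆ₙₐ[ℂ] (Lp ℂ 2 μ →L[ℂ] Lp ℂ 2 μ)),
            Λ.IsStandardProjective μ F ∧ KGraph.ArisesFrom F ρ ∧
              KGraph.UnitarilyEquivalent π ρ) ∧
    (∀ (μ : Measure Λ.InfinitePath) (F : Arrow V → Lp ℂ 2 μ)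
        (ρ : Λ.CStar →⋆ₙₐ[ℂ] (Lp ℂ 2 μ →L[ℂ] Lp ℂ 2 μ)),
      (∀ v : V, μ (KGraph.InfinitePath.vertexCylinder Λ v) < ∞) →
      Λ.IsStandardProjective μ F → KGraph.ArisesFrom F ρ →
        KGraph.IsMonic ρ ∧
          ∀ ξ : Lp ℂ 2 μ, KGraph.IsMonicVector ρ ξ →
            ∃ ν : Measure Λ.InfinitePath, KGraph.IsMonicMeasure ρ ξ ν ∧
              (∀ ν' : Measure Λ.InfinitePath, KGraph.IsMonicMeasure ρ ξ ν' → ν' = ν) ∧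
              Nonempty (Lp ℂ 2 μ ≃ₗᵢ[ℂ] Lp ℂ 2 ν)) := by
  refine ⟨fun H _ _ _ π hπ ξ hξ => ?_, fun μ F ρ hμ hF hρ =>
    ⟨hρ.isMonic hfin hF hμ, fun ξ hξ => ?_⟩⟩
  · obtain ⟨μ, hμ⟩ := KGraph.exists_isMonicMeasure (π := π) hfin hsrc ξ
    exact ⟨μ, hμ, fun μ' hμ' => hμ'.unique hfin hμ, hπ.exists_standardProjective hfin hξ hμ⟩
  · obtain ⟨ν, hν⟩ := KGraph.exists_isMonicMeasure (π := ρ) hfin hsrc ξ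
    -- Only the isometry itself is needed here, so its values on the vectors `p_l ξ` are discarded.
    obtain ⟨U, -⟩ := hξ.exists_unitary hfin hν
    exact ⟨ν, hν, fun ν' hν' => hν'.unique hfin hν, ⟨U⟩⟩
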